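/- Let $k_1\ge k_2\ge 1$ be coprime integers and let $B_{k_1,k_2}\subset\mathbb C^2$ be the curve $x^{k_1}-y^{k_2}=0$. \emph{Chains and resolution.} Consider sequences $\overline\sigma_n=\sigma_1\circ\dots\circ\sigma_n:V_n\to V_0=\mathbb C^2$, $n\ge 1$, where $\sigma_i:V_i\to V_{i-1}$ is the blowup of a point $p_{i-1}$ with exceptional curve $E_i$, $p_0=0$ and $p_j\in E_j$ for $1\le j\le n-1$; the proper transforms of $E_i$ are denoted by $E_i$ again. The sequence is a \emph{chain} if, for every $j\le n-1$ such that $E_j\subset V_j$ meets two other exceptional curves, $p_j$ lies on one of these two curves. A sequence \emph{resolves} a curve germ $B$ at $0$ if $\overline\sigma_n^{-1}(B)$ is a divisor with normal crossings and $n\ge 1$ is minimal with this property. The germ to be resolved is $B=B_{k_1,k_2}$ if $k_2\ge 2$ or $k_1=k_2=1$; for $k_2=1$, $k_1\ge 2$, where $B_{k_1,1}$ is smooth and is regarded as a singular germ through its contact with its tangent line, it is $B=B_{k_1,1}\cup\{y=0\}$. \emph{The invariant.} If the dual graph of $E_1\cup\dots\cup E_n\subset V_n$ is a linear chain beginning with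 $E_1$, let $w_1,\dots,w_n$ be the numbers $-(E_i^2)_{V_n}$ in the order of the chain, and let $n_0$ be the place of $E_n$ in it. Let $D(u_1,\dots,u_m)$ be the determinant of the tridiagonal matrix with diagonal $u_1,\dots,u_m$ and all entries beside the diagonal equal to $1$; it is $1$ for $m=0$, and is read as $0$ for $m=-1$. Put $\overline s_{\overline\sigma_n}=(d_{lt,0},d_{rt,0},d_{lt,1},d_{rt,1})$, where $d_{lt,i}=D(w_1,\dots,w_{n_0-1-i})$ and $d_{rt,i}=D(w_{n_0+1+i},\dots,w_n)$. \emph{The graph.} Let $\mathcal O_{\mathcal D}$ be the set of $s=(k_1,k_2,q_1,q_2)\in\mathbb Z^4$ with $k_1k_2-k_1q_2-k_2q_1=1$, $k_1\ge k_2>0$, $0\le q_1<k_1$ and $0\le q_2<k_2$ (these represent the orbits of the exchange $(k_1,q_1)\leftrightarrow(k_2,q_2)$), and put $\mathrm{pr}(s)=\{k_1,k_2\}$. The graph $\Gamma_{\overline{\mathcal O}_{\mathcal D}}$ has vertex set $\overline{\mathcal O}_{\mathcal D}=\mathcal O_{\mathcal D}\cup\{(1,0,0,-1)\}$, with root $(1,0,0,-1)$.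 From each $s\in\mathcal O_{\mathcal D}$ starts exactly one edge. It is labelled $\varepsilon_1$ and ends in $(k_1-k_2,k_2,q_1+q_2-k_2,q_2)$ if $k_1\ge 2k_2$; it is labelled $\varepsilon_2$ and ends in $(k_2,k_1-k_2,q_2,q_1+q_2-k_2)$ if $k_1<2k_2$. Let $n_{\mathcal E}(k_1,k_2)$ be the number of steps of the additive algorithm of Euclid, which replaces $\{a,b\}$, $a>b$, by $\{a-b,b\}$ until both numbers are equal, and call $\mathrm{ln}(s)=n_{\mathcal E}(\mathrm{pr}(s))+1$ the level of $s\in\mathcal O_{\mathcal D}$. \textbf{Theorem.} There is exactly one chain $\overline\sigma_n$ that resolves the germ $B$. For it the dual graph of $E_1\cup\dots\cup E_n$ is a linear chain beginning with $E_1$, and: (1) $\overline s_{\overline\sigma_n}$ is the only element of $\mathcal O_{\mathcal D}$, and the only vertex of $\Gamma_{\overline{\mathcal O}_{\mathcal D}}$, whose projection is $\{k_1,k_2\}$. (2) $\mathrm{ln}(\overline s_{\overline\sigma_n})=n_{\mathcal E}(k_1,k_2)+1=n$. There is exactly one oriented path in $\Gamma_{\overline{\mathcal O}_{\mathcal D}}$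 from $\overline s_{\overline\sigma_n}$ to the root; it has $n$ edges, and for $i=1,\dots,n$ the blowup $\sigma_i$ corresponds to the $i$-th edge of the path, and to no other edge of it, in the following sense: if $\{a,b\}$, $a\ge b$, is the projection of the start of the edge, then the proper transform of $B_{k_1,k_2}$ at the centre $p_{i-1}$ of $\sigma_i$ is given by $u^a-v^b=0$ or by $u^b-v^a=0$, where $(u,v)$ are the coordinates at $p_{i-1}$ obtained from $(x,y)$ by passing successively to the standard chart of each blowup, moved to the centre (at each step $(u,v)=(u',u'(v'+c))$ or $(u,v)=(u'v',v')$); and the edge is labelled $\varepsilon_1$ if $a\ge 2b$ and $\varepsilon_2$ if $a<2b$. -/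

import Mathlib

open MvPolynomial

noncomputable section

namespace SigmaProcess

/-! ### Sigma-processes over the origin of the complex plane

`V₀ = ℂ²` with coordinates `x = X 0`, `y = X 1`.  The exceptional line of a blowup is the projective
line `OnePoint ℂ`: the point `z` stands for the direction `(z₁ : z₂)` with `z = z₂ / z₁`. -/

/-- Polynomial functions of two variables, in the coordinates centred at some point. -/
abbrev Poly := MvPolynomial (Fin 2) ℂ

/-- The blowup of the origin, written in coordinates `(u, v)` centred at the point `z` of the
exceptional line: `(x, y) = (u, u (v + c))` at the direction `(1 : c)`, which is the origin of the
chart `z₁ ≠ 0` moved to that point, and `(x, y) = (u v, v)` at the direction `(0 : 1)`. -/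
def blowupChart (z : OnePoint ℂ) : Fin 2 → Poly :=
  z.elim ![X 0 * X 1, X 1] (fun c => ![X 0, X 0 * (X 1 + C c)])

/-- The equation of the exceptional line of the blowup in the coordinates centred at its point `z`. -/
def excEq (z : OnePoint ℂ) : Poly :=
  z.elim (X 1) (fun _ => X 0)

/-- Pullback of a function under the blowup, in the coordinates centred at the point `z`. -/
def pull (z : OnePoint ℂ) (f : Poly) : Poly :=
  aeval (blowupChart z) f

/-- `removeFactor e g` is the quotient of `g` by the highest power of `e` that divides it. -/
def removeFactor (e g : Poly) : Poly :=
  Classical.choose (pow_multiplicity_dvd e g)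

/-- The equation at the point `z` of the proper transform, under the blowup, of the curve `g = 0`. -/
def properTransform (z : OnePoint ℂ) (g : Poly) : Poly :=
  removeFactor (excEq z) (pull z g)

/-- An infinitely near point of the origin: the list `[z₁, …, z_j]` is the point `z_j` on the
exceptional line of the blowup with centre `[z₁, …, z_{j-1}]`; the empty list is the origin of `V₀`.

A sequence `σ₁ ∘ ⋯ ∘ σ_n : (V_n, p_n) → (V₀, p₀)` of `n ≥ 1` sigma-processes with centres
`p₀ = 0`, `p₁ ∈ E₁`, …, `p_{n-1} ∈ E_{n-1}` is given by the list `cs = [p₁, …, p_{n-1}]`, where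
`p_j`, as an infinitely near point, is `cs.take j`.  The curves `E₁, …, E_n` are numbered from zero
below: the curve with number `i` comes from the blowup with centre `cs.take i`. -/
abbrev NearPoint := List (OnePoint ℂ)

/-- The number `n` of sigma-processes in the sequence with centres `0, p₁, …, p_{n-1}`. -/
def numBlowups (cs : NearPoint) : ℕ := cs.length + 1

/-- The points of `V_n` that lie over the origin of `V₀`: a point of the exceptional line of one of
the blowups of the sequence which is not itself blown up. -/
def pointsOver (cs : NearPoint) : Set NearPoint :=
  {w | w ≠ [] ∧ w.dropLast <+: cs ∧ ¬ w <+: cs}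

/-- The pullback to the infinitely near point `w` of a function on `V₀`, in the coordinates centred
at `w`. -/
def total (f : Poly) (w : NearPoint) : Poly :=
  w.foldl (fun g z => pull z g) f

/-- The equation at the infinitely near point `w` of the proper transform of the curve `f = 0`. -/
def proper (f : Poly) (w : NearPoint) : Poly :=
  w.foldl (fun g z => properTransform z g) f

/-- The equation at `w` of the (proper transform of the) exceptional curve with number `i`, that is,
of the exceptional line of the blowup with centre `w.take i`.  It is `1` if this curve does not exist
at the level of `w` yet. -/
def curveEq (i : ℕ) (w : NearPoint) : Poly :=
  match w.drop i with
  | [] => 1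
  | z :: rest => proper (excEq z) rest

/-- The point `w` lies on the exceptional curve with number `i`. -/
def OnCurve (i : ℕ) (w : NearPoint) : Prop :=
  constantCoeff (curveEq i w) = 0

/-- A sequence of sigma-processes is a *chain* if, whenever `E_j ⊂ V_j` meets two other exceptional
curves, the next centre `p_j ∈ E_j` lies on one of them.  (In the code `E_j` has number `m = j - 1`,
and the centres of `V_j → V₀` besides the origin are `cs.take m`.) -/
def IsSigmaChain (cs : NearPoint) : Prop :=
  ∀ m < cs.length, ∀ i₁ < m, ∀ i₂ < m, i₁ ≠ i₂ →
    (∃ w ∈ pointsOver (cs.take m), OnCurve m w ∧ OnCurve i₁ w) →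
    (∃ w ∈ pointsOver (cs.take m), OnCurve m w ∧ OnCurve i₂ w) →
    OnCurve i₁ (cs.take (m + 1)) ∨ OnCurve i₂ (cs.take (m + 1))

/-! ### Intersection numbers -/

/-- The local intersection number at the origin of the curves `f = 0` and `g = 0`:
`dim ℂ⟦u, v⟧ / (f, g)`. -/
def localInt (f g : Poly) : ℕ :=
  Module.finrank ℂ (MvPowerSeries (Fin 2) ℂ ⧸
    Ideal.span {(f : MvPowerSeries (Fin 2) ℂ), (g : MvPowerSeries (Fin 2) ℂ)})

/-- The intersection number in `V_n` of two different exceptional curves. -/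
def interNumber (cs : NearPoint) (i j : ℕ) : ℕ :=
  ∑ᶠ w ∈ pointsOver cs, localInt (curveEq i w) (curveEq j w)

/-- The order of vanishing of the pullback of `f` along the exceptional curve with number `i`. -/
def ordAlong (cs : NearPoint) (i : ℕ) (f : Poly) : ℕ :=
  multiplicity (X 0 : Poly) (pull ((0 : ℂ) : OnePoint ℂ) (total f (cs.take i)))

/-- `d` is the self-intersection number in `V_n` of the exceptional curve `E` with number `i`, that
is, the degree on `E` of the line bundle `O(E)`: for every function `f ≠ 0` on `V₀` with order `m`
along `E`, the divisor `m E` is linearly equivalent to `-(div f - m E)`, which does not contain `E`,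
and hence `m d = -(div f - m E, E)`. -/
def IsSelfInter (cs : NearPoint) (i : ℕ) (d : ℤ) : Prop :=
  ∀ f : Poly, f ≠ 0 →
    (ordAlong cs i f : ℤ) * d =
      -∑ᶠ w ∈ pointsOver cs,
        (localInt (curveEq i w) (removeFactor (curveEq i w) (total f w)) : ℤ)

/-- The self-intersection number in `V_n` of the exceptional curve with number `i`. -/
def selfInter (cs : NearPoint) (i : ℕ) : ℤ :=
  Classical.epsilon (IsSelfInter cs i)

/-! ### The invariant of a chain of sigma-processes -/

/-- A numbering `β` of the exceptional curves along their dual graph, which is a linear chain: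
it begins with `E₁`, consecutive curves have intersection number `1`, and all other pairs of
different curves have intersection number `0`. -/
def IsChainNumbering (cs : NearPoint) (β : Equiv.Perm (Fin (numBlowups cs))) : Prop :=
  β ⟨0, Nat.succ_pos _⟩ = ⟨0, Nat.succ_pos _⟩ ∧
  ∀ i j, i < j → interNumber cs (β i) (β j) = if (j : ℕ) = i + 1 then 1 else 0

/-- The weights `w_j = -(E_{β(j)}²)` of the dual graph, in the order of the chain. -/
def weights (cs : NearPoint) (β : Equiv.Perm (Fin (numBlowups cs))) : List ℤ :=
  List.ofFn fun j => -selfInter cs (β j)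

/-- The number of vertices to the left of the centre of the chain, i.e. of the vertex of the last
exceptional curve `E_n`. -/
def leftLength (cs : NearPoint) (β : Equiv.Perm (Fin (numBlowups cs))) : ℕ :=
  β.symm (Fin.last cs.length)

/-- The matrix of a weighted chain: weights on the diagonal, ones beside it. -/
def chainMatrix (l : List ℤ) : Matrix (Fin l.length) (Fin l.length) ℤ :=
  fun i j => if i = j then l.get i
    else if (j : ℕ) = i + 1 ∨ (i : ℕ) = j + 1 then 1 else 0

/-- The determinant of a weighted chain (`1` for the empty chain). -/
def chainDet (l : List ℤ) : ℤ := (chainMatrix l).det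

/-- A quadruple `(k₁, k₂, q₁, q₂)` of integers, also written `(k₁/q₁, k₂/q₂)`. -/
@[ext] structure Quad where
  k₁ : ℤ
  k₂ : ℤ
  q₁ : ℤ
  q₂ : ℤ

/-- The invariant `s̄ = (d_{lt,0}, d_{rt,0}, d_{lt,1}, d_{rt,1})`: the determinants of the left and of
the right part of the exceptional chain, and those of these parts without the vertex that is adjacent
to the centre (`0` if the part is empty). -/
def sBar (cs : NearPoint) (β : Equiv.Perm (Fin (numBlowups cs))) : Quad :=
  let lt := (weights cs β).take (leftLength cs β)
  let rt := (weights cs β).drop (leftLength cs β + 1)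
  { k₁ := chainDet lt
    k₂ := chainDet rt
    q₁ := if lt = [] then 0 else chainDet lt.dropLast
    q₂ := if rt = [] then 0 else chainDet rt.tail }

/-! ### Resolution by normal crossings -/

/-- The divisor `F = 0` has normal crossings at the origin: in suitable local coordinates `s, t` it
is given by `s ^ a * t ^ b = 0`. -/
def IsNormalCrossing (F : Poly) : Prop :=
  ∃ (e s t : MvPowerSeries (Fin 2) ℂ) (a b : ℕ),
    IsUnit e ∧ MvPowerSeries.constantCoeff s = 0 ∧ MvPowerSeries.constantCoeff t = 0 ∧
    MvPowerSeries.coeff (Finsupp.single 0 1) s * MvPowerSeries.coeff (Finsupp.single 1 1) t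
      - MvPowerSeries.coeff (Finsupp.single 1 1) s * MvPowerSeries.coeff (Finsupp.single 0 1) t ≠ 0 ∧
    (F : MvPowerSeries (Fin 2) ℂ) = e * s ^ a * t ^ b

/-- The inverse image in `V_n` of the curve germ `f = 0` is a divisor with normal crossings. -/
def HasNormalCrossings (f : Poly) (cs : NearPoint) : Prop :=
  ∀ w ∈ pointsOver cs, IsNormalCrossing (total f w)

/-- A sequence of `n > 0` sigma-processes resolves the germ `f = 0` at the origin if the inverse image
of the germ is a divisor with normal crossings and `n` is minimal with this property. -/
def Resolves (f : Poly) (cs : NearPoint) : Prop :=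
  HasNormalCrossings f cs ∧
    ∀ cs' : NearPoint, HasNormalCrossings f cs' → numBlowups cs ≤ numBlowups cs'

/-- The equation `x ^ k₁ - y ^ k₂` of the curve `B_{k₁,k₂}`. -/
def curveB (k₁ k₂ : ℕ) : Poly := X 0 ^ k₁ - X 1 ^ k₂

/-- The germ that is resolved: `B_{k₁,k₂}` itself, except for the smooth germs `y = x ^ k`, `k ≥ 2`,
which are distinguished from each other, and regarded as singular, through their contact with the
tangent line `y = 0`: they are resolved together with this line. -/
def germ (k₁ k₂ : ℕ) : Poly :=
  if k₂ = 1 ∧ 2 ≤ k₁ then curveB k₁ k₂ * X 1 else curveB k₁ k₂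

/-! ### The sets `O`, `O_D`, the additive algorithm of Euclid and the graph -/

/-- The set `O` of pairs `{k₁, k₂}` of coprime positive integers, `k₁ ≥ k₂`. -/
def setO : Set (ℕ × ℕ) :=
  {k | 0 < k.1 ∧ 0 < k.2 ∧ Nat.Coprime k.1 k.2 ∧ k.2 ≤ k.1}

/-- The number of steps of the additive algorithm of Euclid, which replaces `{a, b}`, `a > b`, by
`{a - b, b}` until the two numbers are equal. (For `b = 0` or `a < b` the value is immaterial.) -/
def euclidSteps (a b : ℕ) : ℕ :=
  if h : b = 0 ∨ a ≤ b then 0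
  else if 2 * b ≤ a then euclidSteps (a - b) b + 1
  else euclidSteps b (a - b) + 1
termination_by a
decreasing_by all_goals omega

/-- The solutions `(k₁, k₂, q₁, q₂)` of `k₁ k₂ - k₁ q₂ - k₂ q₁ = 1` with `k_i > 0`, `0 ≤ q_i < k_i`. -/
def setDP : Set Quad :=
  {s | s.k₁ * s.k₂ - s.k₁ * s.q₂ - s.k₂ * s.q₁ = 1 ∧ 0 < s.k₁ ∧ 0 < s.k₂ ∧
    0 ≤ s.q₁ ∧ s.q₁ < s.k₁ ∧ 0 ≤ s.q₂ ∧ s.q₂ < s.k₂}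

/-- The set `O_D` of orbits `{k₁/q₁, k₂/q₂}` of the exchange of `k₁/q₁` and `k₂/q₂` on `setDP`; an
orbit is represented by its only element with `k₁ ≥ k₂`. -/
def setOD : Set Quad := {s ∈ setDP | s.k₂ ≤ s.k₁}

/-- The additional element `{k₁/q₁, k₂/q₂}` with `k₁ = 1`, `q₁ = 0`, `k₂ = 0`, `q₂ = -1`. -/
def root : Quad := ⟨1, 0, 0, -1⟩

/-- The vertices of the graph: `O_D` with the root added. -/
def setODbar : Set Quad := setOD ∪ {root}

/-- The projection `{k₁/q₁, k₂/q₂} ↦ {k₁, k₂}`. -/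
def pr (s : Quad) : ℤ × ℤ := (s.k₁, s.k₂)

/-- The level of a vertex. -/
def level (s : Quad) : ℕ := euclidSteps s.k₁.toNat s.k₂.toNat + 1

/-- The labels of the edges. -/
inductive EdgeLabel
  | eps₁
  | eps₂

/-- A labelled arrow between two quadruples. -/
structure Arrow where
  src : Quad
  label : EdgeLabel
  tgt : Quad

/-- The edges of the graph: every vertex `{k₁/q₁, k₂/q₂}` except the root is the start of one edge,
labelled by `ε₁` if `k₁ ≥ 2 k₂` (with equality only for `{2/1, 1/0}`), and by `ε₂` if `k₁ < 2 k₂`;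
the edge ends in the image of its start under the transformation that is its label. -/
def IsEdge (e : Arrow) : Prop :=
  e.src ∈ setOD ∧
  match e.label with
  | .eps₁ => 2 * e.src.k₂ ≤ e.src.k₁ ∧
      e.tgt = ⟨e.src.k₁ - e.src.k₂, e.src.k₂, e.src.q₁ + e.src.q₂ - e.src.k₂, e.src.q₂⟩
  | .eps₂ => e.src.k₁ < 2 * e.src.k₂ ∧
      e.tgt = ⟨e.src.k₂, e.src.k₁ - e.src.k₂, e.src.q₂, e.src.q₁ + e.src.q₂ - e.src.k₂⟩

/-- The list of edges `L` is an oriented path from the vertex `s` to the vertex `t`. -/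
def IsPath (s t : Quad) : List Arrow → Prop
  | [] => s = t ∧ s ∈ setODbar
  | e :: L => IsEdge e ∧ e.src = s ∧ IsPath e.tgt t L

/-- The edge `e` corresponds to the sigma-process `σ_{i+1}` of the sequence: if `{a, b}` is the
projection of the start of `e`, then at the centre `p_i` of `σ_{i+1}` the proper transform `B_i` of
`B_{k₁,k₂}` is given, up to the order of the two coordinates, by `x_i ^ a - y_i ^ b = 0`; and `e` is
labelled by `ε₁` if `a ≥ 2 b` and by `ε₂` if `a < 2 b`. -/
def Corresponds (k₁ k₂ : ℕ) (cs : NearPoint) (i : ℕ) (e : Arrow) : Prop :=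
  ∃ a b : ℕ, pr e.src = ((a : ℤ), (b : ℤ)) ∧
    (proper (curveB k₁ k₂) (cs.take i) = X 0 ^ a - X 1 ^ b ∨
      proper (curveB k₁ k₂) (cs.take i) = X 0 ^ b - X 1 ^ a) ∧
    (2 * b ≤ a → e.label = .eps₁) ∧ (a < 2 * b → e.label = .eps₂)

end SigmaProcess

end

open SigmaProcess

/-!
The pull-back of a germ to an infinitely near point is computed in the chart of the last blowup,
and there the only curves that matter are the two coordinate axes: an exceptional curve through an
infinitely near point is one of them (`exists_curveEq_eq_X`), and different curves are different
axes (`curveEq_injective`).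

*The resolution.* At the centres prescribed by the algorithm of Euclid (`EuclidPath`) the proper
transform of `x ^ k₁ = y ^ k₂` is `u ^ a = v ^ b`, where `(a, b)` is the current pair, and the
total transform of the germ is this curve together with multiples of the axes. Such a divisor never
has normal crossings at a centre other than the origin: each of its branches would lie on one of
two transversal smooth curves `s = 0` and `t = 0`, and parametrizing the branches, one sees that the
linear parts of `s` and `t` would be dependent. At all other points the total transform is a product
of powers of the coordinates and a unit. Hence every centre must be blown up, and nothing else
(`resolves_iff`). The next centre is always one of the two points of the
exceptional line that lie on an axis, which gives the chain condition.

*Intersection numbers.* The local intersection number with an axis is the order of vanishing of the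
restriction to it (`localInt_X`). A function with a zero of order `m` at a point restricts, after
the blowup, to its initial form on the exceptional line, which has `m` zeros there
(`exists_order_eq_on_excLine`); so the new curve has self-intersection `-1` (`selfInter_length`).
On an older curve through the centre the blowup adds the order of the function along that curve to
the number of zeros, which lowers the self-intersection by one (`selfInter_append`). Two old curves
through the centre are separated, and the new curve meets both (`interNumber_append`,
`interNumber_length`). It follows that each blowup inserts the new curve into the linear chain at
the centre (`ExcState`).

*The invariant.* Let `A` and `B` be the determinants of the left and of the right part of the
chain, and `A'` and `B'` those of the parts without the vertex next to the centre. The recursion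
for tridiagonal determinants turns a blowup into a linear substitution, under which
`A B - A B' - B A' = 1`, `k₁ = (A - A') a + A' b` and `k₂ = (B - B') b + B' a` are invariant
(`EuclidPath.dets`). At the end `a = b = 1`, so that `A = k₁` and `B = k₂`.

*The graph.* An element of `O_D` is determined by its projection, and on projections an edge is a
step of the algorithm of Euclid (`exists_path`). So the path from the invariant to the root runs
through the same pairs as the proper transforms at the centres. The pair determines the number of
remaining steps, hence the place of the edge and of the centre (`EuclidPath.corresponds_iff`).
-/

noncomputable section

namespace SigmaProcess

open scoped OnePoint

/-! ### Restriction to a coordinate axis -/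

/-- The restriction of a polynomial function to the coordinate axis `X s = 0`, as a polynomial in
the other coordinate. -/
def restrict (s : Fin 2) : Poly →ₐ[ℂ] Polynomial ℂ :=
  aeval fun i => if i = s then 0 else Polynomial.X

@[simp] lemma restrict_X_self (s : Fin 2) : restrict s (X s) = 0 := by simp [restrict]

lemma restrict_X_of_ne {s t : Fin 2} (h : t ≠ s) : restrict s (X t) = Polynomial.X := by
  simp [restrict, h]

@[simp] lemma restrict_C (s : Fin 2) (c : ℂ) : restrict s (C c) = Polynomial.C c := by
  simp [restrict, Polynomial.C_eq_algebraMap]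

lemma X_dvd_sub_aeval_restrict {s t : Fin 2} (h : t ≠ s) (g : Poly) :
    X s ∣ g - Polynomial.aeval (X t : Poly) (restrict s g) := by
  induction g using MvPolynomial.induction_on with
  | C a => simp
  | add p q hp hq =>
    rw [map_add, map_add, add_sub_add_comm]
    exact dvd_add hp hq
  | mul_X p i hp =>
    rw [map_mul, map_mul]
    by_cases hi : i = s
    · subst hi
      simp
    · have : i = t := by omega
      subst this
      rw [restrict_X_of_ne h, Polynomial.aeval_X, ← sub_mul]
      exact hp.mul_right _

lemma X_dvd_iff_restrict_eq_zero {s : Fin 2} {g : Poly} : X s ∣ g ↔ restrict s g = 0 := by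
  constructor
  · rintro ⟨h, rfl⟩
    simp
  · intro h
    obtain ⟨t, ht⟩ := exists_ne s
    simpa [h] using X_dvd_sub_aeval_restrict ht g

/-! ### Removal of a factor -/

lemma pow_multiplicity_mul_removeFactor (e g : Poly) :
    e ^ multiplicity e g * removeFactor e g = g :=
  (Classical.choose_spec (pow_multiplicity_dvd e g)).symm

lemma multiplicity_X_pow_mul {s : Fin 2} {h : Poly} (n : ℕ) (hh : ¬ X s ∣ h) :
    multiplicity (X s) (X s ^ n * h) = n := by
  refine multiplicity_eq_of_dvd_of_not_dvd (dvd_mul_right _ _) fun H => hh ?_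
  rw [pow_succ] at H
  exact (mul_dvd_mul_iff_left (pow_ne_zero n (X_ne_zero s))).1 H

lemma removeFactor_X_pow_mul {s : Fin 2} {h : Poly} (n : ℕ) (hh : ¬ X s ∣ h) :
    removeFactor (X s) (X s ^ n * h) = h := by
  have := pow_multiplicity_mul_removeFactor (X s) (X s ^ n * h)
  rw [multiplicity_X_pow_mul n hh] at this
  exact mul_left_cancel₀ (pow_ne_zero n (X_ne_zero s)) this

lemma removeFactor_X_of_not_dvd {s : Fin 2} {h : Poly} (hh : ¬ X s ∣ h) :
    removeFactor (X s) h = h := by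
  simpa using removeFactor_X_pow_mul 0 hh

lemma not_X_dvd_of_constantCoeff_ne_zero {s : Fin 2} {g : Poly} (hg : constantCoeff g ≠ 0) :
    ¬ X s ∣ g := by
  rintro ⟨h, rfl⟩
  simp at hg

lemma exists_eq_X_pow_mul (s : Fin 2) {g : Poly} (hg : g ≠ 0) :
    ∃ m h, g = X s ^ m * h ∧ ¬ X s ∣ h := by
  have hf : FiniteMultiplicity (X s : Poly) g :=
    FiniteMultiplicity.of_prime_left (X_prime) hg
  obtain ⟨h, hh, hd⟩ := hf.exists_eq_pow_mul_and_not_dvd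
  exact ⟨_, h, hh, hd⟩

/-! ### The blowup of a point -/

/-- The index of the coordinate that vanishes on the exceptional line. -/
def excIndex (z : OnePoint ℂ) : Fin 2 := z.elim 1 fun _ => 0

lemma excEq_eq_X (z : OnePoint ℂ) : excEq z = X (excIndex z) := by
  cases z <;> rfl

@[simp] lemma excEq_infty : excEq ∞ = X 1 := rfl
@[simp] lemma excEq_coe (c : ℂ) : excEq (c : OnePoint ℂ) = X 0 := rfl
@[simp] lemma excIndex_infty : excIndex ∞ = 1 := rfl
@[simp] lemma excIndex_coe (c : ℂ) : excIndex (c : OnePoint ℂ) = 0 := rfl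

/-- The pullback of functions under a blowup, as a homomorphism of algebras. -/
def pullHom (z : OnePoint ℂ) : Poly →ₐ[ℂ] Poly := aeval (blowupChart z)

lemma pull_eq (z : OnePoint ℂ) (f : Poly) : pull z f = pullHom z f := rfl

@[simp] lemma pullHom_infty_X_zero : pullHom ∞ (X 0) = X 0 * X 1 := by
  simp [pullHom, blowupChart]

@[simp] lemma pullHom_infty_X_one : pullHom ∞ (X 1) = X 1 := by
  simp [pullHom, blowupChart]

@[simp] lemma pullHom_coe_X_zero (c : ℂ) : pullHom (c : OnePoint ℂ) (X 0) = X 0 := by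
  simp [pullHom, blowupChart]

@[simp] lemma pullHom_coe_X_one (c : ℂ) :
    pullHom (c : OnePoint ℂ) (X 1) = X 0 * (X 1 + C c) := by
  simp [pullHom, blowupChart]

lemma constantCoeff_pull (z : OnePoint ℂ) (f : Poly) :
    constantCoeff (pull z f) = constantCoeff f := by
  have : (constantCoeff.comp (pullHom z).toRingHom : Poly →+* ℂ) = constantCoeff := by
    ext i
    · simp
    · cases z <;> fin_cases i <;> simp
  exact congrArg (fun φ : Poly →+* ℂ => φ f) this

lemma constantCoeff_properTransform_ne_zero {z : OnePoint ℂ} {g : Poly}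
    (hg : constantCoeff g ≠ 0) : constantCoeff (properTransform z g) ≠ 0 := by
  have h : constantCoeff (pull z g) ≠ 0 := by rwa [constantCoeff_pull]
  rwa [properTransform, excEq_eq_X,
    removeFactor_X_of_not_dvd (not_X_dvd_of_constantCoeff_ne_zero h)]

lemma properTransform_eq {z : OnePoint ℂ} {g h : Poly} (n : ℕ)
    (e : pull z g = X (excIndex z) ^ n * h) (hh : ¬ X (excIndex z) ∣ h) :
    properTransform z g = h := by
  rw [properTransform, excEq_eq_X, e, removeFactor_X_pow_mul n hh]

lemma not_X_zero_dvd_X_one_add_C (c : ℂ) : ¬ (X 0 : Poly) ∣ X 1 + C c := by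
  rw [X_dvd_iff_restrict_eq_zero]
  simpa [restrict] using Polynomial.X_add_C_ne_zero c

@[simp] lemma properTransform_infty_X_zero : properTransform ∞ (X 0) = X 0 :=
  properTransform_eq 1 (by simp [pull_eq, mul_comm]) (by simp)

@[simp] lemma properTransform_infty_X_one : properTransform ∞ (X 1) = 1 :=
  properTransform_eq 1 (by simp [pull_eq]) (by simp [X_dvd_iff_restrict_eq_zero])

@[simp] lemma properTransform_coe_X_zero (c : ℂ) :
    properTransform (c : OnePoint ℂ) (X 0) = 1 :=
  properTransform_eq 1 (by simp [pull_eq]) (by simp [X_dvd_iff_restrict_eq_zero])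

@[simp] lemma properTransform_coe_X_one (c : ℂ) :
    properTransform (c : OnePoint ℂ) (X 1) = X 1 + C c :=
  properTransform_eq 1 (by simp [pull_eq]) (not_X_zero_dvd_X_one_add_C c)

/-! ### The exceptional curves near an infinitely near point -/

@[simp] lemma total_nil (f : Poly) : total f [] = f := rfl

@[simp] lemma total_append_singleton (f : Poly) (w : NearPoint) (z : OnePoint ℂ) :
    total f (w ++ [z]) = pull z (total f w) := by simp [total]

@[simp] lemma proper_nil (f : Poly) : proper f [] = f := rfl

@[simp] lemma proper_append_singleton (f : Poly) (w : NearPoint) (z : OnePoint ℂ) :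
    proper f (w ++ [z]) = properTransform z (proper f w) := by simp [proper]

lemma curveEq_append_of_lt {i : ℕ} {w : NearPoint} (h : i < w.length) (z : OnePoint ℂ) :
    curveEq i (w ++ [z]) = properTransform z (curveEq i w) := by
  unfold curveEq
  rw [List.drop_append_of_le_length h.le]
  obtain ⟨y, r, hr⟩ : ∃ y r, w.drop i = y :: r :=
    ⟨_, _, List.drop_eq_getElem_cons h⟩
  rw [hr]
  exact proper_append_singleton _ _ _

@[simp] lemma curveEq_append_length (w : NearPoint) (z : OnePoint ℂ) :
    curveEq w.length (w ++ [z]) = excEq z := by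
  simp [curveEq]

lemma curveEq_of_length_le {i : ℕ} {w : NearPoint} (h : w.length ≤ i) : curveEq i w = 1 := by
  simp [curveEq, List.drop_eq_nil_of_le h]

lemma not_onCurve_of_length_le {i : ℕ} {w : NearPoint} (h : w.length ≤ i) : ¬ OnCurve i w := by
  simp [OnCurve, curveEq_of_length_le h]

lemma onCurve_length_append (w : NearPoint) (z : OnePoint ℂ) : OnCurve w.length (w ++ [z]) := by
  simp [OnCurve, excEq_eq_X]

lemma onCurve_of_append {i : ℕ} {w : NearPoint} {z : OnePoint ℂ} (hi : i < w.length)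
    (h : OnCurve i (w ++ [z])) : OnCurve i w := by
  by_contra hn
  rw [OnCurve, curveEq_append_of_lt hi] at h
  exact constantCoeff_properTransform_ne_zero hn h

/-- An exceptional curve that passes through an infinitely near point is one of the two coordinate
axes at this point. -/
lemma exists_curveEq_eq_X {i : ℕ} {w : NearPoint} (h : OnCurve i w) :
    ∃ s, curveEq i w = X s := by
  induction w using List.reverseRecOn with
  | nil => exact (not_onCurve_of_length_le (by simp) h).elim
  | append_singleton w z ih =>
    rcases lt_trichotomy i w.length with hi | rfl | hi
    · obtain ⟨s, hs⟩ := ih (onCurve_of_append hi h)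
      rw [OnCurve, curveEq_append_of_lt hi, hs] at h
      rw [curveEq_append_of_lt hi, hs]
      cases z with
      | infty =>
        fin_cases s
        · exact ⟨0, by simp⟩
        · simp at h
      | coe c =>
        fin_cases s
        · simp at h
        · refine ⟨1, ?_⟩
          have : c = 0 := by simpa using h
          simp [this]
    · exact ⟨_, by rw [curveEq_append_length, excEq_eq_X]⟩
    · exact (not_onCurve_of_length_le (by simp; omega) h).elim

/-- Different exceptional curves through an infinitely near point are different axes. -/
lemma curveEq_injective {i j : ℕ} {w : NearPoint} {s : Fin 2} (hi : curveEq i w = X s)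
    (hj : curveEq j w = X s) : i = j := by
  induction w using List.reverseRecOn generalizing s with
  | nil =>
    rw [curveEq_of_length_le (by simp)] at hi
    exact absurd (congrArg constantCoeff hi) (by simp)
  | append_singleton w z ih =>
    have on {k : ℕ} (hk : curveEq k (w ++ [z]) = X s) : OnCurve k (w ++ [z]) := by
      simp [OnCurve, hk]
    have lt {k : ℕ} (hk : curveEq k (w ++ [z]) = X s) : k < w.length ∨ k = w.length := by
      by_contra hn
      exact not_onCurve_of_length_le (by simp; omega) (on hk)
    -- The old curve at `w ++ [z]` is the axis with the same index as at `w`, and not the new one.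
    have old {k : ℕ} (hk : curveEq k (w ++ [z]) = X s) (hlt : k < w.length) :
        curveEq k w = X s ∧ s ≠ excIndex z := by
      obtain ⟨t, ht⟩ := exists_curveEq_eq_X (onCurve_of_append hlt (on hk))
      rw [curveEq_append_of_lt hlt, ht] at hk
      have h0 : constantCoeff (properTransform z (X t)) = 0 := by simp [hk]
      cases z with
      | infty =>
        fin_cases t
        · have hk' : (X 0 : Poly) = X s := by simpa using hk
          obtain rfl := X_injective hk'
          exact ⟨ht, by simp⟩
        · simp at h0
      | coe c =>
        fin_cases t
        · simp at h0
        · have : c = 0 := by simpa using h0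
          subst this
          have hk' : (X 1 : Poly) = X s := by simpa using hk
          obtain rfl := X_injective hk'
          exact ⟨ht, by simp⟩
    have new {k : ℕ} (hk : curveEq k (w ++ [z]) = X s) (he : k = w.length) :
        s = excIndex z := by
      subst he
      rw [curveEq_append_length, excEq_eq_X] at hk
      exact (X_injective hk).symm
    rcases lt hi with h1 | h1 <;> rcases lt hj with h2 | h2
    · exact ih (old hi h1).1 (old hj h2).1
    · exact absurd (new hj h2) (old hi h1).2
    · exact absurd (new hi h1) (old hj h2).2
    · omega

/-! ### Local intersection numbers with the coordinate axes -/

lemma localInt_comm (f g : Poly) : localInt f g = localInt g f := by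
  rw [localInt, localInt, Set.pair_comm]

lemma isUnit_coe_of_constantCoeff_ne_zero {f : Poly} (hf : constantCoeff f ≠ 0) :
    IsUnit (f : MvPowerSeries (Fin 2) ℂ) := by
  rw [MvPowerSeries.isUnit_iff_constantCoeff, isUnit_iff_ne_zero,
    ← MvPowerSeries.coeff_zero_eq_constantCoeff_apply, MvPolynomial.coeff_coe]
  simpa [constantCoeff_eq] using hf

lemma localInt_of_constantCoeff_ne_zero_left {f : Poly} (hf : constantCoeff f ≠ 0) (g : Poly) :
    localInt f g = 0 := by
  have : Ideal.span {(f : MvPowerSeries (Fin 2) ℂ), (g : MvPowerSeries (Fin 2) ℂ)} = ⊤ :=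
    Ideal.eq_top_of_isUnit_mem _ (Ideal.subset_span (by simp))
      (isUnit_coe_of_constantCoeff_ne_zero hf)
  rw [localInt, this]
  have : Subsingleton (MvPowerSeries (Fin 2) ℂ ⧸ (⊤ : Ideal (MvPowerSeries (Fin 2) ℂ))) :=
    Ideal.Quotient.subsingleton_iff.2 rfl
  exact Module.finrank_zero_of_subsingleton

lemma localInt_of_constantCoeff_ne_zero_right (f : Poly) {g : Poly} (hg : constantCoeff g ≠ 0) :
    localInt f g = 0 := by
  rw [localInt_comm, localInt_of_constantCoeff_ne_zero_left hg]

/-- A power series lies in the ideal `(X s, X t ^ r)` if and only if its pure `X t` part starts at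
degree `r`. -/
lemma mem_span_X_X_pow_iff {s t : Fin 2} (hst : t ≠ s) (r : ℕ) (f : MvPowerSeries (Fin 2) ℂ) :
    f ∈ Ideal.span {(MvPowerSeries.X s : MvPowerSeries (Fin 2) ℂ), MvPowerSeries.X t ^ r} ↔
      ∀ i < r, MvPowerSeries.coeff (Finsupp.single t i) f = 0 := by
  classical
  have eq_single (m : Fin 2 →₀ ℕ) (hm : m s = 0) : m = Finsupp.single t (m t) := by
    ext i
    by_cases hi : i = s
    · subst hi
      simp [hm, hst]
    · have : i = t := by omega
      subst this
      simp
  rw [Ideal.mem_span_pair]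
  constructor
  · rintro ⟨a, b, rfl⟩ i hi
    have h1 : MvPowerSeries.X s ∣ a * MvPowerSeries.X s := dvd_mul_left _ _
    have h2 : MvPowerSeries.X t ^ r ∣ b * MvPowerSeries.X t ^ r := dvd_mul_left _ _
    rw [MvPowerSeries.X_dvd_iff] at h1
    rw [MvPowerSeries.X_pow_dvd_iff] at h2
    rw [map_add, h1 _ (by simp [hst]), h2 _ (by simpa using hi), add_zero]
  · intro h
    let f₁ : MvPowerSeries (Fin 2) ℂ := fun m => if m s = 0 then 0 else MvPowerSeries.coeff m f
    let f₂ : MvPowerSeries (Fin 2) ℂ := fun m => if m s = 0 then MvPowerSeries.coeff m f else 0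
    have c₁ (m) : MvPowerSeries.coeff m f₁ = if m s = 0 then 0 else MvPowerSeries.coeff m f := rfl
    have c₂ (m) : MvPowerSeries.coeff m f₂ = if m s = 0 then MvPowerSeries.coeff m f else 0 := rfl
    obtain ⟨a, ha⟩ : MvPowerSeries.X s ∣ f₁ := by
      rw [MvPowerSeries.X_dvd_iff]
      intro m hm
      simp [c₁, hm]
    obtain ⟨b, hb⟩ : MvPowerSeries.X t ^ r ∣ f₂ := by
      rw [MvPowerSeries.X_pow_dvd_iff]
      intro m hm
      rw [c₂]
      split_ifs with h0
      · rw [eq_single m h0]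
        exact h _ hm
      · rfl
    refine ⟨a, b, ?_⟩
    rw [mul_comm, ← ha, mul_comm, ← hb]
    ext m
    rw [map_add, c₁, c₂]
    split_ifs <;> simp

lemma finrank_quotient_span_X_X_pow {s t : Fin 2} (hst : t ≠ s) (r : ℕ) :
    Module.finrank ℂ (MvPowerSeries (Fin 2) ℂ ⧸
      Ideal.span {(MvPowerSeries.X s : MvPowerSeries (Fin 2) ℂ), MvPowerSeries.X t ^ r}) = r := by
  classical
  let φ : MvPowerSeries (Fin 2) ℂ →ₗ[ℂ] (Fin r → ℂ) :=
    LinearMap.pi fun i => MvPowerSeries.coeff (Finsupp.single t (i : ℕ))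
  have hφ : Function.Surjective φ := by
    intro a
    refine ⟨fun m => if h : m t < r then a ⟨m t, h⟩ else 0, ?_⟩
    ext i
    change (if h : (Finsupp.single t (i : ℕ)) t < r then a ⟨_, h⟩ else 0) = a i
    simp
  have hker : (Ideal.span {(MvPowerSeries.X s : MvPowerSeries (Fin 2) ℂ),
      MvPowerSeries.X t ^ r}).restrictScalars ℂ = LinearMap.ker φ := by
    ext f
    rw [Submodule.restrictScalars_mem, mem_span_X_X_pow_iff hst, LinearMap.mem_ker, funext_iff]
    exact ⟨fun h i => h i i.2, fun h i hi => h ⟨i, hi⟩⟩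
  have e : (MvPowerSeries (Fin 2) ℂ ⧸ Ideal.span {(MvPowerSeries.X s : MvPowerSeries (Fin 2) ℂ),
      MvPowerSeries.X t ^ r}) ≃ₗ[ℂ] (Fin r → ℂ) :=
    (Submodule.Quotient.restrictScalarsEquiv ℂ _).symm ≪≫ₗ
      Submodule.quotEquivOfEq _ _ hker ≪≫ₗ φ.quotKerEquivOfSurjective hφ
  rw [e.finrank_eq, Module.finrank_fin_fun]

/-- The local intersection number with an axis is the order of vanishing of the restriction. -/
lemma localInt_X {s : Fin 2} {h : Poly} (hh : ¬ X s ∣ h) :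
    localInt (X s) h = (restrict s h).rootMultiplicity 0 := by
  obtain ⟨t, hst⟩ := exists_ne s
  have h0 : restrict s h ≠ 0 := fun H => hh (X_dvd_iff_restrict_eq_zero.2 H)
  set r := (restrict s h).rootMultiplicity 0 with hr
  obtain ⟨q, hq, hqd⟩ := (restrict s h).exists_eq_pow_rootMultiplicity_mul_and_not_dvd h0 0
  rw [← hr, Polynomial.C_0, sub_zero] at hq
  rw [Polynomial.C_0, sub_zero, Polynomial.X_dvd_iff, Polynomial.coeff_zero_eq_aeval_zero] at hqd
  obtain ⟨k, hk⟩ := X_dvd_sub_aeval_restrict hst h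
  set u : Poly := Polynomial.aeval (X t : Poly) q with hu
  have hh' : h = X s * k + X t ^ r * u := by
    rw [← hk, hq, map_mul, map_pow, Polynomial.aeval_X]
    ring
  have hun : IsUnit (u : MvPowerSeries (Fin 2) ℂ) := by
    refine isUnit_coe_of_constantCoeff_ne_zero ?_
    have := Polynomial.hom_eval₂ q (algebraMap ℂ Poly) (constantCoeff) (X t)
    rw [hu, Polynomial.aeval_def, this]
    have h2 : (constantCoeff : Poly →+* ℂ).comp (algebraMap ℂ Poly) = algebraMap ℂ ℂ := by
      ext x
      simp [MvPolynomial.algebraMap_eq]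
    rw [h2]
    simpa [Polynomial.aeval_def] using hqd
  have hspan : Ideal.span {((X s : Poly) : MvPowerSeries (Fin 2) ℂ),
      (h : MvPowerSeries (Fin 2) ℂ)} = Ideal.span {MvPowerSeries.X s, MvPowerSeries.X t ^ r} := by
    rw [hh']
    push_cast
    obtain ⟨v, hv⟩ := hun
    apply le_antisymm
    · rw [Ideal.span_le, Set.pair_subset_iff]
      constructor
      · exact Ideal.subset_span (by simp)
      · rw [SetLike.mem_coe, Ideal.mem_span_pair]
        exact ⟨k, u, by ring⟩
    · rw [Ideal.span_le, Set.pair_subset_iff]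
      constructor
      · exact Ideal.subset_span (by simp)
      · rw [SetLike.mem_coe, Ideal.mem_span_pair]
        refine ⟨-(↑v⁻¹ * k), ↑v⁻¹, ?_⟩
        rw [← hv]
        linear_combination (MvPowerSeries.X t ^ r) * v.inv_mul
  rw [localInt, hspan, finrank_quotient_span_X_X_pow hst]

lemma localInt_X_X_of_ne {s t : Fin 2} (h : t ≠ s) : localInt (X s) (X t) = 1 := by
  have := restrict_X_of_ne h
  rw [localInt_X, this]
  · simpa using Polynomial.rootMultiplicity_X_sub_C_self (x := (0 : ℂ))
  · rw [X_dvd_iff_restrict_eq_zero, this]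
    exact Polynomial.X_ne_zero

/-! ### Sums over the points of `V_n` -/

/-- The sum of the values of a function on the exceptional line of the blowup with centre `w`. -/
def newSum (T : NearPoint → ℕ) (w : NearPoint) : ℕ := ∑ᶠ z : OnePoint ℂ, T (w ++ [z])

lemma append_mem_pointsOver {cs v : NearPoint} {y : OnePoint ℂ} :
    v ++ [y] ∈ pointsOver cs ↔ v <+: cs ∧ ¬ v ++ [y] <+: cs := by
  simp [pointsOver]

lemma exists_append_of_mem_pointsOver {cs w : NearPoint} (h : w ∈ pointsOver cs) :
    ∃ v y, w = v ++ [y] :=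
  ⟨w.dropLast, w.getLast h.1, (List.dropLast_append_getLast h.1).symm⟩

lemma mem_pointsOver_self (cs : NearPoint) (z : OnePoint ℂ) : cs ++ [z] ∈ pointsOver cs := by
  refine append_mem_pointsOver.2 ⟨List.prefix_rfl, fun h => ?_⟩
  have := h.length_le
  simp at this

lemma length_le_of_mem_pointsOver {cs w : NearPoint} (h : w ∈ pointsOver cs) :
    w.length ≤ cs.length + 1 := by
  have := h.2.1.length_le
  simp at this
  omega

lemma pointsOver_nil : pointsOver [] = Set.range fun z : OnePoint ℂ => ([] ++ [z] : NearPoint) := by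
  ext w
  constructor
  · intro h
    obtain ⟨v, y, rfl⟩ := exists_append_of_mem_pointsOver h
    obtain rfl : v = [] := by simpa using (append_mem_pointsOver.1 h).1
    exact ⟨y, rfl⟩
  · rintro ⟨z, rfl⟩
    exact mem_pointsOver_self [] z

/-- The points over the origin after the blowup of `w = cs ++ [z]`: this point is replaced by the
points of the new exceptional line. -/
lemma pointsOver_append_singleton (cs : NearPoint) (z : OnePoint ℂ) :
    pointsOver (cs ++ [z]) = (pointsOver cs \ {cs ++ [z]}) ∪
      Set.range fun y : OnePoint ℂ => (cs ++ [z]) ++ [y] := by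
  ext w
  constructor
  · intro h
    obtain ⟨v, y, rfl⟩ := exists_append_of_mem_pointsOver h
    obtain ⟨h1, h2⟩ := append_mem_pointsOver.1 h
    rw [List.prefix_concat_iff] at h1 h2
    rcases h1 with rfl | h1
    · exact Or.inr ⟨y, rfl⟩
    · exact Or.inl ⟨append_mem_pointsOver.2 ⟨h1, fun h => h2 (Or.inr h)⟩, fun h => h2 (Or.inl h)⟩
  · rintro (⟨h, hne⟩ | ⟨y, rfl⟩)
    · obtain ⟨v, y, rfl⟩ := exists_append_of_mem_pointsOver h
      obtain ⟨h1, h2⟩ := append_mem_pointsOver.1 h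
      refine append_mem_pointsOver.2 ⟨h1.trans (List.prefix_append _ _), fun h => ?_⟩
      rcases List.prefix_concat_iff.1 h with h | h
      exacts [hne h, h2 h]
    · exact mem_pointsOver_self _ y

lemma append_singleton_injective (w : NearPoint) :
    Function.Injective fun y : OnePoint ℂ => (w ++ [y] : NearPoint) := fun a b h => by
  simpa using h

lemma finite_pointsOver_inter_support {T : NearPoint → ℕ}
    (hT : ∀ w, (Function.support fun z : OnePoint ℂ => T (w ++ [z])).Finite) (cs : NearPoint) :
    (pointsOver cs ∩ Function.support T).Finite := by
  have new (w : NearPoint) :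
      ((Set.range fun z : OnePoint ℂ => w ++ [z]) ∩ Function.support T).Finite := by
    refine ((hT w).image fun z => w ++ [z]).subset ?_
    rintro _ ⟨⟨z, rfl⟩, hz⟩
    exact ⟨z, hz, rfl⟩
  induction cs using List.reverseRecOn with
  | nil => rw [pointsOver_nil]; exact new []
  | append_singleton cs z ih =>
    rw [pointsOver_append_singleton, Set.union_inter_distrib_right]
    exact (ih.subset (by gcongr; exact Set.sdiff_subset)).union (new _)

lemma finsum_pointsOver_nil (T : NearPoint → ℕ) :
    ∑ᶠ w ∈ pointsOver [], T w = newSum T [] := by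
  rw [pointsOver_nil, finsum_mem_range (append_singleton_injective [])]
  rfl

lemma finsum_pointsOver_append {T : NearPoint → ℕ}
    (hT : ∀ w, (Function.support fun z : OnePoint ℂ => T (w ++ [z])).Finite)
    (cs : NearPoint) (z : OnePoint ℂ) :
    (∑ᶠ w ∈ pointsOver (cs ++ [z]), T w) + T (cs ++ [z]) =
      (∑ᶠ w ∈ pointsOver cs, T w) + newSum T (cs ++ [z]) := by
  have hfin := finite_pointsOver_inter_support hT
  have hd : (pointsOver cs \ {cs ++ [z]} ∩ Function.support T).Finite :=
    (hfin cs).subset (by gcongr; exact Set.sdiff_subset)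
  have h1 : ∑ᶠ w ∈ pointsOver cs, T w =
      T (cs ++ [z]) + ∑ᶠ w ∈ pointsOver cs \ {cs ++ [z]}, T w := by
    rw [← finsum_mem_insert' T (by simp) hd]
    congr! 3 with w
    rw [Set.insert_sdiff_singleton, Set.insert_eq_of_mem (mem_pointsOver_self cs z)]
  have h2 : ∑ᶠ w ∈ pointsOver (cs ++ [z]), T w =
      (∑ᶠ w ∈ pointsOver cs \ {cs ++ [z]}, T w) + newSum T (cs ++ [z]) := by
    rw [pointsOver_append_singleton, finsum_mem_union' _ hd,
      finsum_mem_range (append_singleton_injective _)]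
    · rfl
    · refine (hfin (cs ++ [z])).subset ?_
      rw [pointsOver_append_singleton]
      gcongr
      exact Set.subset_union_right
    · rw [Set.disjoint_left]
      rintro w ⟨hw, -⟩ ⟨y, rfl⟩
      have := length_le_of_mem_pointsOver hw
      simp at this
  rw [h1, h2]
  ring

/-! ### Coordinate axes under a blowup -/

/-- The point of the exceptional line through which the proper transform of the axis `X s = 0`
passes. -/
def axisPoint (s : Fin 2) : OnePoint ℂ := if s = 0 then ∞ else ((0 : ℂ) : OnePoint ℂ)

@[simp] lemma axisPoint_zero : axisPoint 0 = ∞ := rfl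
@[simp] lemma axisPoint_one : axisPoint 1 = ((0 : ℂ) : OnePoint ℂ) := rfl

lemma axisPoint_injective : Function.Injective axisPoint := by
  intro s t h
  fin_cases s <;> fin_cases t <;> simp_all

lemma excIndex_axisPoint_ne (s : Fin 2) : excIndex (axisPoint s) ≠ s := by
  fin_cases s <;> simp

lemma properTransform_axisPoint (s : Fin 2) : properTransform (axisPoint s) (X s) = X s := by
  fin_cases s <;> simp

lemma constantCoeff_properTransform_X_ne_zero {s : Fin 2} {z : OnePoint ℂ} (h : z ≠ axisPoint s) :
    constantCoeff (properTransform z (X s)) ≠ 0 := by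
  fin_cases s <;> cases z <;> simp_all

lemma restrict_pull_axisPoint (s : Fin 2) (h : Poly) :
    restrict s (pull (axisPoint s) h) = restrict s h := by
  have : (restrict s).comp (pullHom (axisPoint s)) = restrict s := by
    ext i : 1
    fin_cases s <;> fin_cases i <;> simp [restrict]
  exact congrArg (fun φ : Poly →ₐ[ℂ] Polynomial ℂ => φ h) this

lemma pull_axisPoint_X_self (s : Fin 2) :
    pull (axisPoint s) (X s) = X (excIndex (axisPoint s)) * X s := by
  fin_cases s <;> simp [pull_eq, mul_comm]

/-- At the point where the axis `X s = 0` meets the new exceptional line, the order `m` along the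
axis is unchanged, and `m` is added to the order of vanishing on the axis of the rest. -/
lemma exists_pull_axisPoint_eq {s : Fin 2} {h : Poly} (m : ℕ) (hh : ¬ X s ∣ h) :
    ∃ h', pull (axisPoint s) (X s ^ m * h) = X s ^ m * h' ∧ ¬ X s ∣ h' ∧
      (restrict s h').rootMultiplicity 0 = (restrict s h).rootMultiplicity 0 + m := by
  have hr : restrict s (X (excIndex (axisPoint s)) ^ m * pull (axisPoint s) h) =
      (Polynomial.X - Polynomial.C 0) ^ m * restrict s h := by
    rw [map_mul, map_pow, restrict_X_of_ne (excIndex_axisPoint_ne s), restrict_pull_axisPoint,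
      Polynomial.C_0, sub_zero]
  have h0 : restrict s h ≠ 0 := fun H => hh (X_dvd_iff_restrict_eq_zero.2 H)
  refine ⟨X (excIndex (axisPoint s)) ^ m * pull (axisPoint s) h, ?_, ?_, ?_⟩
  · have := pull_axisPoint_X_self s
    rw [pull_eq] at this
    rw [pull_eq, map_mul, map_pow, this, pull_eq]
    ring
  · rw [X_dvd_iff_restrict_eq_zero, hr]
    exact mul_ne_zero (pow_ne_zero _ (Polynomial.X_sub_C_ne_zero 0)) h0
  · rw [hr, Polynomial.rootMultiplicity_mul
      (mul_ne_zero (pow_ne_zero _ (Polynomial.X_sub_C_ne_zero 0)) h0),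
      Polynomial.rootMultiplicity_X_sub_C_pow, add_comm]

lemma onCurve_append_iff {i : ℕ} {w : NearPoint} {s : Fin 2} (hi : i < w.length)
    (h : curveEq i w = X s) (z : OnePoint ℂ) : OnCurve i (w ++ [z]) ↔ z = axisPoint s := by
  rw [OnCurve, curveEq_append_of_lt hi, h]
  constructor
  · intro H
    by_contra hz
    exact constantCoeff_properTransform_X_ne_zero hz H
  · rintro rfl
    rw [properTransform_axisPoint]
    simp

lemma curveEq_append_axisPoint {i : ℕ} {w : NearPoint} {s : Fin 2} (hi : i < w.length)
    (h : curveEq i w = X s) : curveEq i (w ++ [axisPoint s]) = X s := by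
  rw [curveEq_append_of_lt hi, h, properTransform_axisPoint]

lemma lt_length_of_onCurve {i : ℕ} {w : NearPoint} (h : OnCurve i w) : i < w.length := by
  by_contra hn
  exact not_onCurve_of_length_le (not_lt.1 hn) h

/-! ### Intersection numbers of exceptional curves -/

lemma interNumber_comm (cs : NearPoint) (i j : ℕ) : interNumber cs i j = interNumber cs j i := by
  simp only [interNumber, localInt_comm]

lemma localInt_curveEq_of_not_onCurve {i j : ℕ} {w : NearPoint}
    (h : ¬ (OnCurve i w ∧ OnCurve j w)) : localInt (curveEq i w) (curveEq j w) = 0 := by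
  rcases not_and_or.1 h with h | h
  · exact localInt_of_constantCoeff_ne_zero_left h _
  · exact localInt_of_constantCoeff_ne_zero_right _ h

lemma localInt_curveEq {i j : ℕ} {w : NearPoint} (hij : i ≠ j) (hi : OnCurve i w)
    (hj : OnCurve j w) : localInt (curveEq i w) (curveEq j w) = 1 := by
  obtain ⟨s, hs⟩ := exists_curveEq_eq_X hi
  obtain ⟨t, ht⟩ := exists_curveEq_eq_X hj
  rw [hs, ht]
  refine localInt_X_X_of_ne ?_
  rintro rfl
  exact hij (curveEq_injective hs ht)

lemma finite_support_localInt_curveEq {i j : ℕ} (hij : i < j) (w : NearPoint) :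
    (Function.support fun z : OnePoint ℂ =>
      localInt (curveEq i (w ++ [z])) (curveEq j (w ++ [z]))).Finite := by
  refine (Set.finite_range axisPoint).subset fun z hz => ?_
  have hon : OnCurve i (w ++ [z]) ∧ OnCurve j (w ++ [z]) := by
    by_contra h
    exact hz (localInt_curveEq_of_not_onCurve h)
  have hj := lt_length_of_onCurve hon.2
  have hi : i < w.length := by simp at hj; omega
  obtain ⟨s, hs⟩ := exists_curveEq_eq_X (onCurve_of_append hi hon.1)
  exact ⟨s, ((onCurve_append_iff hi hs z).1 hon.1).symm⟩

lemma newSum_localInt_of_lt {i j : ℕ} {w : NearPoint} (hij : i < j) (hj : j < w.length) :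
    newSum (fun v => localInt (curveEq i v) (curveEq j v)) w = 0 := by
  rw [newSum, finsum_eq_zero_of_forall_eq_zero]
  intro z
  refine localInt_curveEq_of_not_onCurve fun ⟨h1, h2⟩ => ?_
  have hi := hij.trans hj
  obtain ⟨s, hs⟩ := exists_curveEq_eq_X (onCurve_of_append hi h1)
  obtain ⟨t, ht⟩ := exists_curveEq_eq_X (onCurve_of_append hj h2)
  have : s = t := axisPoint_injective
    (((onCurve_append_iff hi hs z).1 h1).symm.trans ((onCurve_append_iff hj ht z).1 h2))
  subst this
  exact hij.ne (curveEq_injective hs ht)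

open Classical in
lemma newSum_localInt_length {i : ℕ} {w : NearPoint} (hi : i < w.length) :
    newSum (fun v => localInt (curveEq i v) (curveEq w.length v)) w =
      if OnCurve i w then 1 else 0 := by
  split_ifs with h
  · obtain ⟨s, hs⟩ := exists_curveEq_eq_X h
    rw [newSum, finsum_eq_single _ (axisPoint s)]
    · refine localInt_curveEq hi.ne ?_ (onCurve_length_append _ _)
      rw [onCurve_append_iff hi hs]
    · intro z hz
      refine localInt_curveEq_of_not_onCurve fun ⟨h1, _⟩ => hz ?_
      exact (onCurve_append_iff hi hs z).1 h1
  · rw [newSum, finsum_eq_zero_of_forall_eq_zero]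
    intro z
    exact localInt_curveEq_of_not_onCurve fun ⟨h1, _⟩ => h (onCurve_of_append hi h1)

lemma finsum_pointsOver_localInt_eq_zero {i j : ℕ} {cs : NearPoint} (hj : cs.length < j) :
    ∑ᶠ w ∈ pointsOver cs, localInt (curveEq i w) (curveEq j w) = 0 := by
  refine finsum_mem_of_eqOn_zero fun w hw => ?_
  refine localInt_curveEq_of_not_onCurve fun ⟨_, h⟩ => ?_
  have := length_le_of_mem_pointsOver hw
  have := lt_length_of_onCurve h
  omega

open Classical in
/-- The last exceptional curve meets, once, the curves through the last centre. -/
lemma interNumber_length {i : ℕ} {cs : NearPoint} (hi : i < cs.length) :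
    interNumber cs i cs.length = if OnCurve i cs then 1 else 0 := by
  rcases List.eq_nil_or_concat' cs with rfl | ⟨v, z, rfl⟩
  · simp at hi
  have := finsum_pointsOver_append
    (T := fun v' => localInt (curveEq i v') (curveEq (v ++ [z]).length v'))
    (finite_support_localInt_curveEq hi) v z
  have h0 : localInt (curveEq i (v ++ [z])) (curveEq (v ++ [z]).length (v ++ [z])) = 0 :=
    localInt_curveEq_of_not_onCurve fun h => (lt_length_of_onCurve h.2).ne rfl
  have h1 := finsum_pointsOver_localInt_eq_zero (i := i) (j := (v ++ [z]).length) (cs := v)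
    (by simp)
  rw [newSum_localInt_length hi, h0, h1, add_zero, zero_add] at this
  exact this

open Classical in
/-- The blowup of a common point of two exceptional curves separates them. -/
lemma interNumber_append {i j : ℕ} {cs : NearPoint} (z : OnePoint ℂ) (hij : i < j)
    (hj : j ≤ cs.length) :
    interNumber (cs ++ [z]) i j + (if OnCurve i (cs ++ [z]) ∧ OnCurve j (cs ++ [z]) then 1 else 0) =
      interNumber cs i j := by
  have := finsum_pointsOver_append
    (T := fun v' => localInt (curveEq i v') (curveEq j v'))
    (finite_support_localInt_curveEq hij) cs z
  rw [newSum_localInt_of_lt hij (by simp; omega), add_zero] at this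
  rw [interNumber, interNumber, ← this]
  congr 1
  split_ifs with h
  · exact (localInt_curveEq hij.ne h.1 h.2).symm
  · exact (localInt_curveEq_of_not_onCurve h).symm

/-! ### Functions on a new exceptional line -/

lemma rootMultiplicity_zero_reflect {P : Polynomial ℂ} (hP : P ≠ 0) {m : ℕ}
    (hm : P.natDegree ≤ m) : (P.reflect m).rootMultiplicity 0 + P.natDegree = m := by
  have h1 : P.reflect m = (Polynomial.X - Polynomial.C 0) ^ (m - P.natDegree) * P.reverse := by
    have := Polynomial.reflect_mul (1 : Polynomial ℂ) P (F := m - P.natDegree) (by simp) le_rfl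
    rw [one_mul, Nat.sub_add_cancel hm, Polynomial.reflect_one] at this
    rw [this, Polynomial.C_0, sub_zero]
    rfl
  have h2 : P.reverse ≠ 0 := by simpa using hP
  have h3 : P.reverse.rootMultiplicity 0 = 0 := by
    apply Polynomial.rootMultiplicity_eq_zero
    rw [Polynomial.IsRoot.def, ← Polynomial.coeff_zero_eq_eval_zero, Polynomial.coeff_zero_reverse]
    simpa using hP
  rw [h1, Polynomial.rootMultiplicity_mul
    (mul_ne_zero (pow_ne_zero _ (Polynomial.X_sub_C_ne_zero 0)) h2),
    Polynomial.rootMultiplicity_X_sub_C_pow, h3]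
  omega

lemma finsum_rootMultiplicity (P : Polynomial ℂ) :
    (Function.support fun c => P.rootMultiplicity c).Finite ∧
      ∑ᶠ c, P.rootMultiplicity c = P.natDegree := by
  classical
  have hs : (Function.support fun c => P.rootMultiplicity c) ⊆ P.roots.toFinset := by
    intro c hc
    rw [Function.mem_support, ← Polynomial.count_roots, Multiset.count_ne_zero] at hc
    simpa using hc
  refine ⟨P.roots.toFinset.finite_toSet.subset hs, ?_⟩
  rw [finsum_eq_sum_of_support_subset _ hs, ← IsAlgClosed.card_roots_eq_natDegree]
  simp_rw [← Polynomial.count_roots]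
  exact Multiset.toFinset_sum_count_eq _

/-- The pullback of a function `F` with a zero of order `m` is divisible by the `m`-th power of the
exceptional line, and the rest restricts to this line as the initial form of `F`. It is given here
by its dehomogenization `P` and, at infinity, by the reversed polynomial. -/
lemma exists_initialForm {F : Poly} (hF : F ≠ 0) :
    ∃ (m : ℕ) (P : Polynomial ℂ), P ≠ 0 ∧ P.natDegree ≤ m ∧
      (∀ c : ℂ, ∃ h, pull (c : OnePoint ℂ) F = X 0 ^ m * h ∧
        restrict 0 h = P.comp (Polynomial.X + Polynomial.C c)) ∧
      ∃ h, pull ∞ F = X 1 ^ m * h ∧ restrict 1 h = P.reflect m := by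
  obtain ⟨e₀, he₀, hmin⟩ := F.support.exists_min_image (fun e => e 0 + e 1)
    (MvPolynomial.support_nonempty.2 hF)
  set m := e₀ 0 + e₀ 1 with hm
  have hexp (e : Fin 2 →₀ ℕ) (a : ℂ) : (monomial e a : Poly) = C a * (X 0 ^ e 0 * X 1 ^ e 1) := by
    rw [monomial_eq, Finsupp.prod_fintype _ _ (by simp)]
    simp
  have hsum : F = ∑ e ∈ F.support, C (coeff e F) * (X 0 ^ e 0 * X 1 ^ e 1) := by
    conv_lhs => rw [F.as_sum]
    exact Finset.sum_congr rfl fun e _ => hexp e _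
  refine ⟨m, ∑ e ∈ F.support, Polynomial.C (coeff e F * 0 ^ (e 0 + e 1 - m)) * Polynomial.X ^ e 1,
    ?_, ?_, fun c => ⟨∑ e ∈ F.support, C (coeff e F) * (X 0 ^ (e 0 + e 1 - m) * (X 1 + C c) ^ e 1),
      ?_, ?_⟩, ∑ e ∈ F.support, C (coeff e F) * (X 1 ^ (e 0 + e 1 - m) * X 0 ^ e 0), ?_, ?_⟩
  · intro h
    have := congrArg (fun p => Polynomial.coeff p (e₀ 1)) h
    simp only [Polynomial.finsetSum_coeff, Polynomial.coeff_zero, Polynomial.coeff_C_mul_X_pow]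
      at this
    rw [Finset.sum_eq_single e₀] at this
    · exact mem_support_iff.1 he₀ (by simpa [hm] using this)
    · intro e he hne
      split_ifs with h1
      · have : e 0 + e 1 - m ≠ 0 := by
          intro h2
          have h3 := hmin e he
          apply hne
          ext i
          fin_cases i
          · simp
            omega
          · simpa using h1.symm
        simp [this]
      · rfl
    · exact fun h => (h he₀).elim
  · refine Polynomial.natDegree_sum_le_of_forall_le _ _ fun e he => ?_
    by_cases h : e 0 + e 1 - m = 0
    · exact (Polynomial.natDegree_C_mul_X_pow_le _ _).trans (by omega)
    · simp [h]
  · rw [pull_eq]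
    conv_lhs => rw [hsum]
    rw [map_sum, Finset.mul_sum]
    refine Finset.sum_congr rfl fun e he => ?_
    have h1 : X 0 ^ m * X 0 ^ (e 0 + e 1 - m) = (X 0 : Poly) ^ (e 0 + e 1) := by
      rw [← pow_add, Nat.add_sub_cancel' (hmin e he)]
    have h2 : pullHom (c : OnePoint ℂ) (C (coeff e F)) = C (coeff e F) := AlgHom.commutes _ _
    rw [map_mul, map_mul, map_pow, map_pow, pullHom_coe_X_zero, pullHom_coe_X_one, h2, mul_pow]
    linear_combination (-C (coeff e F) * (X 1 + C c) ^ e 1) * h1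
  · rw [map_sum, ← Polynomial.coe_compRingHom_apply, map_sum]
    refine Finset.sum_congr rfl fun e he => ?_
    simp [restrict_X_of_ne (show (1 : Fin 2) ≠ 0 by simp), mul_assoc]
  · rw [pull_eq]
    conv_lhs => rw [hsum]
    rw [map_sum, Finset.mul_sum]
    refine Finset.sum_congr rfl fun e he => ?_
    have h1 : X 1 ^ m * X 1 ^ (e 0 + e 1 - m) = (X 1 : Poly) ^ (e 0 + e 1) := by
      rw [← pow_add, Nat.add_sub_cancel' (hmin e he)]
    have h2 : pullHom ∞ (C (coeff e F)) = C (coeff e F) := AlgHom.commutes _ _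
    rw [map_mul, map_mul, map_pow, map_pow, pullHom_infty_X_zero, pullHom_infty_X_one, h2]
    linear_combination (-C (coeff e F) * X 0 ^ e 0) * h1
  · ext k
    simp only [map_sum, Polynomial.finsetSum_coeff, Polynomial.coeff_reflect]
    refine Finset.sum_congr rfl fun e he => ?_
    rw [map_mul, map_mul, map_pow, map_pow, restrict_X_self, restrict_C,
      restrict_X_of_ne (show (0 : Fin 2) ≠ 1 by simp), Polynomial.coeff_C_mul_X_pow]
    by_cases h : e 0 + e 1 - m = 0
    · have he1 : e 0 + e 1 = m := le_antisymm (by omega) (hmin e he)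
      have : k = e 0 ↔ Polynomial.revAt m k = e 1 := by
        constructor
        · rintro rfl
          rw [Polynomial.revAt_le (by omega)]
          omega
        · intro h'
          rw [← Polynomial.revAt_invol (N := m) (i := k), h', Polynomial.revAt_le (by omega)]
          omega
      simp [h, Polynomial.coeff_X_pow, this]
    · simp [h]

lemma exists_order_eq_on_excLine {F : Poly} (hF : F ≠ 0) :
    ∃ m : ℕ, (∀ z, multiplicity (X (excIndex z)) (pull z F) = m) ∧
      (Function.support fun z : OnePoint ℂ =>
        localInt (excEq z) (removeFactor (excEq z) (pull z F))).Finite ∧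
      ∑ᶠ z : OnePoint ℂ, localInt (excEq z) (removeFactor (excEq z) (pull z F)) = m := by
  obtain ⟨m, P, hP, hdeg, hfin, h, hh, hr⟩ := exists_initialForm hF
  have hR : P.reflect m ≠ 0 := by simpa [Polynomial.reflect_eq_zero_iff] using hP
  have hnd : ¬ X 1 ∣ h := by rwa [X_dvd_iff_restrict_eq_zero, hr]
  have hinf : localInt (excEq ∞) (removeFactor (excEq ∞) (pull ∞ F)) =
      (P.reflect m).rootMultiplicity 0 := by
    rw [hh, excEq_infty, removeFactor_X_pow_mul m hnd, localInt_X hnd, hr]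
  have hcoe (c : ℂ) : localInt (excEq (c : OnePoint ℂ))
      (removeFactor (excEq (c : OnePoint ℂ)) (pull (c : OnePoint ℂ) F)) =
      P.rootMultiplicity c := by
    obtain ⟨k, hk, hkr⟩ := hfin c
    have hkd : ¬ X 0 ∣ k := by
      rw [X_dvd_iff_restrict_eq_zero, hkr]
      exact Polynomial.comp_X_add_C_ne_zero_iff.2 hP
    rw [hk, excEq_coe, removeFactor_X_pow_mul m hkd, localInt_X hkd, hkr,
      ← Polynomial.rootMultiplicity_eq_rootMultiplicity]
  have hsupp : (Function.support fun c : ℂ => localInt (excEq (c : OnePoint ℂ))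
      (removeFactor (excEq (c : OnePoint ℂ)) (pull (c : OnePoint ℂ) F))).Finite := by
    simp_rw [hcoe]
    exact (finsum_rootMultiplicity P).1
  refine ⟨m, fun z => ?_, ?_, ?_⟩
  · cases z with
    | infty => rw [hh, excIndex_infty, multiplicity_X_pow_mul m hnd]
    | coe c =>
      obtain ⟨k, hk, hkr⟩ := hfin c
      rw [hk, excIndex_coe, multiplicity_X_pow_mul]
      rw [X_dvd_iff_restrict_eq_zero, hkr]
      exact Polynomial.comp_X_add_C_ne_zero_iff.2 hP
  · refine ((hsupp.image OnePoint.some).insert ∞).subset ?_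
    intro z hz
    cases z with
    | infty => exact Or.inl rfl
    | coe c => exact Or.inr ⟨c, hz, rfl⟩
  · refine (finsum_option (f := fun z : OnePoint ℂ => localInt (excEq z)
      (removeFactor (excEq z) (pull z F))) hsupp).trans ?_
    refine (congrArg₂ (· + ·) hinf (finsum_congr hcoe)).trans ?_
    rw [(finsum_rootMultiplicity P).2, rootMultiplicity_zero_reflect hP hdeg]

/-! ### Self-intersection numbers -/

lemma pull_ne_zero {z : OnePoint ℂ} {F : Poly} (hF : F ≠ 0) : pull z F ≠ 0 := by
  obtain ⟨m, P, hP, -, hfin, h, hh, hr⟩ := exists_initialForm hF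
  cases z with
  | infty =>
    rw [hh]
    refine mul_ne_zero (pow_ne_zero _ (X_ne_zero _)) ?_
    rintro rfl
    rw [map_zero] at hr
    exact hP (by simpa [Polynomial.reflect_eq_zero_iff] using hr.symm)
  | coe c =>
    obtain ⟨k, hk, hkr⟩ := hfin c
    rw [hk]
    refine mul_ne_zero (pow_ne_zero _ (X_ne_zero _)) ?_
    rintro rfl
    rw [map_zero] at hkr
    exact Polynomial.comp_X_add_C_ne_zero_iff.2 hP hkr.symm

lemma total_ne_zero {f : Poly} (hf : f ≠ 0) (w : NearPoint) : total f w ≠ 0 := by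
  induction w using List.reverseRecOn with
  | nil => exact hf
  | append_singleton w z ih =>
    rw [total_append_singleton]
    exact pull_ne_zero ih

/-- The local contribution at `w` to the intersection number of the exceptional curve with number
`i` and the part of the divisor of `f` that does not contain it. -/
def residualInt (f : Poly) (i : ℕ) (w : NearPoint) : ℕ :=
  localInt (curveEq i w) (removeFactor (curveEq i w) (total f w))

lemma residualInt_of_not_onCurve {f : Poly} {i : ℕ} {w : NearPoint} (h : ¬ OnCurve i w) :
    residualInt f i w = 0 :=
  localInt_of_constantCoeff_ne_zero_left h _

lemma multiplicity_curveEq_total {f : Poly} (hf : f ≠ 0) {i : ℕ} {w : NearPoint}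
    (h : OnCurve i w) : multiplicity (curveEq i w) (total f w) = ordAlong w i f := by
  induction w using List.reverseRecOn with
  | nil => exact (not_onCurve_of_length_le (by simp) h).elim
  | append_singleton w z ih =>
    have hlt := lt_length_of_onCurve h
    rw [List.length_append, List.length_singleton, Nat.lt_succ_iff_lt_or_eq] at hlt
    rcases hlt with hi | rfl
    · obtain ⟨s, hs⟩ := exists_curveEq_eq_X (onCurve_of_append hi h)
      obtain rfl := (onCurve_append_iff hi hs z).1 h
      have ih := ih (onCurve_of_append hi h)
      obtain ⟨m, k, hk, hkd⟩ := exists_eq_X_pow_mul s (total_ne_zero hf w)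
      obtain ⟨k', hk', hkd', -⟩ := exists_pull_axisPoint_eq m hkd
      rw [hs, hk, multiplicity_X_pow_mul m hkd] at ih
      rw [curveEq_append_axisPoint hi hs, total_append_singleton, hk, hk',
        multiplicity_X_pow_mul m hkd', ih, ordAlong, ordAlong, List.take_append_of_le_length hi.le]
    · obtain ⟨m, hm, -⟩ := exists_order_eq_on_excLine (total_ne_zero hf w)
      rw [curveEq_append_length, excEq_eq_X, total_append_singleton, hm, ordAlong,
        List.take_left]
      exact (hm ((0 : ℂ) : OnePoint ℂ)).symm

lemma finite_support_residualInt {f : Poly} (hf : f ≠ 0) (i : ℕ) (w : NearPoint) :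
    (Function.support fun z : OnePoint ℂ => residualInt f i (w ++ [z])).Finite := by
  rcases lt_trichotomy i w.length with hi | rfl | hi
  · refine (Set.finite_range axisPoint).subset fun z hz => ?_
    have hon : OnCurve i (w ++ [z]) := by
      by_contra h
      exact hz (residualInt_of_not_onCurve h)
    obtain ⟨s, hs⟩ := exists_curveEq_eq_X (onCurve_of_append hi hon)
    exact ⟨s, ((onCurve_append_iff hi hs z).1 hon).symm⟩
  · obtain ⟨m, -, h, -⟩ := exists_order_eq_on_excLine (total_ne_zero hf w)
    simpa [residualInt] using h
  · convert Set.finite_empty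
    ext z
    simpa using residualInt_of_not_onCurve (not_onCurve_of_length_le (by simp; omega))

lemma newSum_residualInt_length {f : Poly} (hf : f ≠ 0) (w : NearPoint) :
    newSum (residualInt f w.length) w = ordAlong w w.length f := by
  obtain ⟨m, hm, -, h⟩ := exists_order_eq_on_excLine (total_ne_zero hf w)
  have h0 : ordAlong w w.length f = m := by
    rw [ordAlong, List.take_length]
    exact hm ((0 : ℂ) : OnePoint ℂ)
  rw [h0, ← h, newSum]
  simp [residualInt]

open Classical in
lemma newSum_residualInt_of_lt {f : Poly} (hf : f ≠ 0) {i : ℕ} {w : NearPoint}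
    (hi : i < w.length) :
    newSum (residualInt f i) w =
      residualInt f i w + if OnCurve i w then ordAlong w i f else 0 := by
  split_ifs with h
  · obtain ⟨s, hs⟩ := exists_curveEq_eq_X h
    obtain ⟨m, k, hk, hkd⟩ := exists_eq_X_pow_mul s (total_ne_zero hf w)
    obtain ⟨k', hk', hkd', hr⟩ := exists_pull_axisPoint_eq m hkd
    have hord := multiplicity_curveEq_total hf h
    rw [hs, hk, multiplicity_X_pow_mul m hkd] at hord
    rw [newSum, finsum_eq_single _ (axisPoint s)]
    · rw [residualInt, residualInt, curveEq_append_axisPoint hi hs, hs, total_append_singleton, hk,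
        hk', removeFactor_X_pow_mul m hkd, removeFactor_X_pow_mul m hkd', localInt_X hkd,
        localInt_X hkd', hr, hord]
    · intro z hz
      exact residualInt_of_not_onCurve fun H => hz ((onCurve_append_iff hi hs z).1 H)
  · rw [newSum, residualInt_of_not_onCurve h]
    refine finsum_eq_zero_of_forall_eq_zero fun z => ?_
    exact residualInt_of_not_onCurve fun H => h (onCurve_of_append hi H)

lemma finsum_residualInt_eq_zero {f : Poly} {i : ℕ} {cs : NearPoint} (h : cs.length < i) :
    ∑ᶠ w ∈ pointsOver cs, residualInt f i w = 0 := by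
  refine finsum_mem_of_eqOn_zero fun w hw => ?_
  refine residualInt_of_not_onCurve fun h' => ?_
  have := length_le_of_mem_pointsOver hw
  have := lt_length_of_onCurve h'
  omega

lemma isSelfInter_iff (cs : NearPoint) (i : ℕ) (d : ℤ) : IsSelfInter cs i d ↔
    ∀ f : Poly, f ≠ 0 → (ordAlong cs i f : ℤ) * d =
      -((∑ᶠ w ∈ pointsOver cs, residualInt f i w : ℕ) : ℤ) := by
  refine forall₂_congr fun f hf => ?_
  have := (Nat.castAddMonoidHom ℤ).map_finsum_mem' (s := pointsOver cs) (f := residualInt f i)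
    (finite_pointsOver_inter_support (finite_support_residualInt hf i) cs)
  rw [Nat.coe_castAddMonoidHom] at this
  rw [this]
  rfl

lemma isSelfInter_length (cs : NearPoint) : IsSelfInter cs cs.length (-1) := by
  rw [isSelfInter_iff]
  intro f hf
  suffices ∑ᶠ w ∈ pointsOver cs, residualInt f cs.length w = ordAlong cs cs.length f by
    rw [this]
    ring
  rcases List.eq_nil_or_concat' cs with rfl | ⟨v, z, rfl⟩
  · exact (finsum_pointsOver_nil _).trans (newSum_residualInt_length hf [])
  · have := finsum_pointsOver_append (finite_support_residualInt hf (v ++ [z]).length) v z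
    have h0 : ∑ᶠ w ∈ pointsOver v, residualInt f (v ++ [z]).length w = 0 :=
      finsum_residualInt_eq_zero (by simp)
    rwa [newSum_residualInt_length hf, h0,
      residualInt_of_not_onCurve (not_onCurve_of_length_le le_rfl), add_zero, zero_add] at this

open Classical in
lemma IsSelfInter.append {cs : NearPoint} {i : ℕ} {d : ℤ} (h : IsSelfInter cs i d)
    (hi : i ≤ cs.length) (z : OnePoint ℂ) :
    IsSelfInter (cs ++ [z]) i (d - if OnCurve i (cs ++ [z]) then 1 else 0) := by
  rw [isSelfInter_iff] at h ⊢
  intro f hf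
  have h1 := finsum_pointsOver_append (finite_support_residualInt hf i) cs z
  rw [newSum_residualInt_of_lt hf (by simp; omega)] at h1
  have h2 : ordAlong (cs ++ [z]) i f = ordAlong cs i f := by
    rw [ordAlong, ordAlong, List.take_append_of_le_length hi]
  have h3 := h f hf
  rw [h2] at h1 ⊢
  split_ifs at h1 ⊢ <;> zify at h1 <;> linarith

lemma exists_isSelfInter {cs : NearPoint} {i : ℕ} (hi : i ≤ cs.length) :
    ∃ d, IsSelfInter cs i d := by
  induction cs using List.reverseRecOn with
  | nil => exact ⟨-1, by simpa [Nat.le_zero.1 hi] using isSelfInter_length []⟩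
  | append_singleton cs z ih =>
    rcases Nat.lt_or_ge cs.length i with h | h
    · obtain rfl : i = (cs ++ [z]).length := by simp at hi ⊢; omega
      exact ⟨-1, isSelfInter_length _⟩
    · obtain ⟨d, hd⟩ := ih h
      exact ⟨_, hd.append h z⟩

lemma ordAlong_X_zero_ne_zero (cs : NearPoint) (i : ℕ) : ordAlong cs i (X 0) ≠ 0 := by
  rw [ordAlong, multiplicity_ne_zero, X_dvd_iff_restrict_eq_zero]
  have h (w : NearPoint) : constantCoeff (total (X 0) w) = 0 := by
    induction w using List.reverseRecOn with
    | nil => simp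
    | append_singleton w z ih => rw [total_append_singleton, constantCoeff_pull, ih]
  have h2 : (restrict 0).comp (pullHom ((0 : ℂ) : OnePoint ℂ)) = (Algebra.ofId ℂ _).comp
      (aeval fun _ => (0 : ℂ)) := by
    ext i : 1
    fin_cases i <;> simp
  have h3 := congrArg (fun φ : Poly →ₐ[ℂ] Polynomial ℂ => φ (total (X 0) (cs.take i))) h2
  exact h3.trans (by simp [h])

lemma IsSelfInter.selfInter_eq {cs : NearPoint} {i : ℕ} {d : ℤ} (h : IsSelfInter cs i d) :
    selfInter cs i = d := by
  have h1 : IsSelfInter cs i (selfInter cs i) := Classical.epsilon_spec ⟨d, h⟩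
  have h2 := (h1 (X 0) (X_ne_zero 0)).trans (h (X 0) (X_ne_zero 0)).symm
  exact mul_left_cancel₀ (Nat.cast_ne_zero.2 (ordAlong_X_zero_ne_zero cs i)) h2

/-- The exceptional line of the last blowup has self-intersection `-1`. -/
lemma selfInter_length (cs : NearPoint) : selfInter cs cs.length = -1 :=
  (isSelfInter_length cs).selfInter_eq

open Classical in
/-- The blowup of a point of an exceptional curve lowers its self-intersection by one. -/
lemma selfInter_append {cs : NearPoint} {i : ℕ} (hi : i ≤ cs.length) (z : OnePoint ℂ) :
    selfInter (cs ++ [z]) i = selfInter cs i - if OnCurve i (cs ++ [z]) then 1 else 0 := by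
  obtain ⟨d, hd⟩ := exists_isSelfInter hi
  rw [hd.selfInter_eq, (hd.append hi z).selfInter_eq]

/-! ### Normal crossings -/

lemma isNormalCrossing_of_eq {F g : Poly} (a b : ℕ) (hF : F = X 0 ^ a * X 1 ^ b * g)
    (hg : constantCoeff g ≠ 0) : IsNormalCrossing F := by
  classical
  refine ⟨g, MvPowerSeries.X 0, MvPowerSeries.X 1, a, b, isUnit_coe_of_constantCoeff_ne_zero hg,
    by simp, by simp, ?_, ?_⟩
  · simp [MvPowerSeries.coeff_X, Finsupp.single_left_inj]
  · rw [hF]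
    push_cast
    ring

/-- A parametrized branch on which `F` vanishes lies on one of the two coordinate curves of a normal
crossing. -/
lemma exists_subst_eq_zero {F G : Poly} {γ : Fin 2 → PowerSeries ℂ}
    (hγ : MvPowerSeries.HasSubst γ) (hGF : G ∣ F) (hG : aeval γ G = 0)
    {e s t : MvPowerSeries (Fin 2) ℂ} {a b : ℕ} (he : IsUnit e)
    (hF : (F : MvPowerSeries (Fin 2) ℂ) = e * s ^ a * t ^ b) :
    MvPowerSeries.subst γ s = 0 ∨ MvPowerSeries.subst γ t = 0 := by
  obtain ⟨H, rfl⟩ := hGF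
  have h := congrArg (MvPowerSeries.substAlgHom (R := ℂ) hγ) hF
  rw [MvPowerSeries.substAlgHom_coe, map_mul, hG, zero_mul, map_mul, map_mul, map_pow, map_pow,
    eq_comm, mul_eq_zero, mul_eq_zero] at h
  rw [← MvPowerSeries.substAlgHom_apply hγ, ← MvPowerSeries.substAlgHom_apply hγ]
  rcases h with (h | h) | h
  · exact ((he.map (MvPowerSeries.substAlgHom (R := ℂ) hγ)).ne_zero h).elim
  · exact Or.inl (eq_zero_of_pow_eq_zero h)
  · exact Or.inr (eq_zero_of_pow_eq_zero h)

/-- The branch `X s = T ^ n s`, with both exponents positive. -/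
def powBranch (n : Fin 2 → ℕ) : Fin 2 → PowerSeries ℂ := fun i => PowerSeries.X ^ n i

lemma hasSubst_powBranch {n : Fin 2 → ℕ} (hn : ∀ i, n i ≠ 0) :
    MvPowerSeries.HasSubst (powBranch n) := by
  refine MvPowerSeries.hasSubst_of_constantCoeff_zero fun i => ?_
  change PowerSeries.constantCoeff (PowerSeries.X ^ n i) = 0
  simp [hn i]

/-- The branch `X s = T`, `X t = 0`, that is, the axis `X t = 0`. -/
def axisBranch (s : Fin 2) : Fin 2 → PowerSeries ℂ := fun i => if i = s then PowerSeries.X else 0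

lemma hasSubst_axisBranch (s : Fin 2) : MvPowerSeries.HasSubst (axisBranch s) := by
  refine MvPowerSeries.hasSubst_of_constantCoeff_zero fun i => ?_
  rw [axisBranch]
  split_ifs
  · exact PowerSeries.constantCoeff_X
  · simp

lemma coeff_eq_zero_of_subst_powBranch {n : Fin 2 → ℕ} (hn : ∀ i, n i ≠ 0)
    {f : MvPowerSeries (Fin 2) ℂ} (hf : MvPowerSeries.subst (powBranch n) f = 0)
    (d : Fin 2 →₀ ℕ)
    (hd : ∀ d' : Fin 2 →₀ ℕ, n 0 * d' 0 + n 1 * d' 1 = n 0 * d 0 + n 1 * d 1 → d' ≠ d →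
      MvPowerSeries.coeff d' f = 0) : MvPowerSeries.coeff d f = 0 := by
  have h : PowerSeries.coeff (n 0 * d 0 + n 1 * d 1)
      (MvPowerSeries.subst (powBranch n) f : PowerSeries ℂ) = 0 := by
    rw [hf]
    exact map_zero (PowerSeries.coeff _)
  rw [PowerSeries.coeff, MvPowerSeries.coeff_subst (hasSubst_powBranch hn)] at h
  have hc (d' : Fin 2 →₀ ℕ) (k : ℕ) : MvPowerSeries.coeff (Finsupp.single () k)
      (d'.prod fun s e => powBranch n s ^ e) = if k = n 0 * d' 0 + n 1 * d' 1 then 1 else 0 := by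
    rw [Finsupp.prod_fintype _ _ (by simp), Fin.prod_univ_two, powBranch, powBranch, ← pow_mul,
      ← pow_mul, ← pow_add]
    exact PowerSeries.coeff_X_pow _ _
  simp_rw [hc] at h
  rw [finsum_eq_single _ d] at h
  · simpa using h
  · intro d' hne
    by_cases h' : n 0 * d 0 + n 1 * d 1 = n 0 * d' 0 + n 1 * d' 1
    · rw [hd d' h'.symm hne, zero_smul]
    · rw [if_neg h', smul_zero]

lemma coeff_single_eq_zero_of_subst_axisBranch {s : Fin 2} {f : MvPowerSeries (Fin 2) ℂ}
    (hf : MvPowerSeries.subst (axisBranch s) f = 0) (k : ℕ) :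
    MvPowerSeries.coeff (Finsupp.single s k) f = 0 := by
  have h := congrArg (PowerSeries.coeff k) hf
  rw [map_zero, PowerSeries.coeff, MvPowerSeries.coeff_subst (hasSubst_axisBranch s)] at h
  rw [finsum_eq_single _ (Finsupp.single s k)] at h
  · rw [Finsupp.prod_single_index (by simp), axisBranch, if_pos rfl] at h
    have h1 : MvPowerSeries.coeff (Finsupp.single () k) (PowerSeries.X ^ k : PowerSeries ℂ) = 1 :=
      (PowerSeries.coeff_X_pow k k).trans (if_pos rfl)
    rw [h1] at h
    simpa using h
  · intro d hd
    obtain ⟨t, hst⟩ := exists_ne s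
    have hp : (d.prod fun i e => axisBranch s i ^ e) = PowerSeries.X ^ d s * 0 ^ d t := by
      rw [Finsupp.prod_of_support_subset d (s := {s, t}) _ _ (by simp), Finset.prod_pair hst.symm]
      · simp [axisBranch, hst]
      · intro i _
        simp; omega
    rw [hp]
    by_cases h0 : d t = 0
    · have hk : k ≠ d s := by
        rintro rfl
        apply hd
        ext i
        by_cases hi : i = s
        · simp [hi]
        · obtain rfl : i = t := by omega
          simp [h0, hst.symm]
      rw [h0, pow_zero, mul_one]
      have h1 : MvPowerSeries.coeff (Finsupp.single () k)
          (PowerSeries.X ^ d s : PowerSeries ℂ) = 0 :=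
        (PowerSeries.coeff_X_pow k (d s)).trans (if_neg hk)
      rw [h1, smul_zero]
    · simp [h0]

/-- The cusp `x ^ a = y ^ b` is not smooth, hence not part of a normal crossing. -/
lemma not_isNormalCrossing_of_cusp {F : Poly} {a b : ℕ} (ha : 2 ≤ a) (hb : 2 ≤ b)
    (hab : a.Coprime b) (hF : X 0 ^ a - X 1 ^ b ∣ F) : ¬ IsNormalCrossing F := by
  rintro ⟨e, s, t, m, n, he, hs0, ht0, hJ, hFe⟩
  have hn : ∀ i, (![b, a] : Fin 2 → ℕ) i ≠ 0 := by
    intro i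
    fin_cases i <;> simp <;> omega
  have key (f : MvPowerSeries (Fin 2) ℂ) (hf : MvPowerSeries.subst (powBranch ![b, a]) f = 0) :
      MvPowerSeries.coeff (Finsupp.single 0 1) f = 0 ∧
        MvPowerSeries.coeff (Finsupp.single 1 1) f = 0 := by
    constructor <;> refine coeff_eq_zero_of_subst_powBranch hn hf _ fun d hd hne => (hne ?_).elim
    -- The weight `b` is attained by the first linear monomial only, since `a` does not divide `b`.
    · have hd' : b * d 0 + a * d 1 = b := by simpa using hd
      have h1 : d 0 ≠ 0 := by
        intro h
        rw [h, mul_zero, zero_add] at hd'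
        have := hab.eq_one_of_dvd ⟨_, hd'.symm⟩
        omega
      have h2 : d 0 = 1 := by nlinarith [Nat.pos_of_ne_zero h1, Nat.zero_le (a * d 1)]
      have h3 : d 1 = 0 := by
        rw [h2] at hd'
        have : a * d 1 = 0 := by omega
        rcases Nat.mul_eq_zero.1 this with h | h
        · omega
        · exact h
      ext i
      fin_cases i <;> simp [h2, h3]
    · have hd' : b * d 0 + a * d 1 = a := by simpa using hd
      have h1 : d 1 ≠ 0 := by
        intro h
        rw [h, mul_zero, add_zero] at hd'
        have := hab.symm.eq_one_of_dvd ⟨_, hd'.symm⟩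
        omega
      have h2 : d 1 = 1 := by nlinarith [Nat.pos_of_ne_zero h1, Nat.zero_le (b * d 0)]
      have h3 : d 0 = 0 := by
        rw [h2] at hd'
        have : b * d 0 = 0 := by omega
        rcases Nat.mul_eq_zero.1 this with h | h
        · omega
        · exact h
      ext i
      fin_cases i <;> simp [h2, h3]
  rcases exists_subst_eq_zero (hasSubst_powBranch hn) hF
    (by simp [powBranch, ← pow_mul, mul_comm]) he hFe with h | h
  · obtain ⟨h1, h2⟩ := key _ h
    simp [h1, h2] at hJ
  · obtain ⟨h1, h2⟩ := key _ h
    simp [h1, h2] at hJ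

/-- A smooth branch and its tangent line do not cross normally. -/
lemma not_isNormalCrossing_of_tangent {F : Poly} {a : ℕ} (ha : 2 ≤ a) {s t : Fin 2} (hst : t ≠ s)
    (h1 : X t ∣ F) (h2 : X s ^ a - X t ∣ F) : ¬ IsNormalCrossing F := by
  rintro ⟨e, f, g, m, n, he, -, -, hJ, hFe⟩
  set ν : Fin 2 → ℕ := fun i => if i = s then 1 else a with hν
  have hn : ∀ i, ν i ≠ 0 := by
    intro i
    simp only [hν]
    split_ifs <;> omega
  have hνs : ν s = 1 := by simp [hν]
  have hνt : ν t = a := by simp [hν, hst]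
  have hsum (d : Fin 2 →₀ ℕ) : ν 0 * d 0 + ν 1 * d 1 = d s + a * d t := by
    obtain ⟨rfl, rfl⟩ | ⟨rfl, rfl⟩ : (s = 0 ∧ t = 1) ∨ (s = 1 ∧ t = 0) := by omega
    · rw [hνs, hνt, one_mul]
    · rw [hνs, hνt, one_mul, add_comm]
  have ext' {d : Fin 2 →₀ ℕ} {x y : ℕ} (hs : d s = x) (ht : d t = y) :
      d = Finsupp.single s x + Finsupp.single t y := by
    ext i
    by_cases hi : i = s
    · simp [hi, hs, hst]
    · obtain rfl : i = t := by omega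
      simp [ht, hst.symm]
  have curve_s {f : MvPowerSeries (Fin 2) ℂ} (hf : MvPowerSeries.subst (powBranch ν) f = 0) :
      MvPowerSeries.coeff (Finsupp.single s 1) f = 0 := by
    refine coeff_eq_zero_of_subst_powBranch hn hf _ fun d hd hne => (hne ?_).elim
    rw [hsum, hsum] at hd
    simp [hst.symm] at hd
    have ht : d t = 0 := by
      by_contra h
      have : a * 1 ≤ a * d t := Nat.mul_le_mul_left a (Nat.pos_of_ne_zero h)
      omega
    rw [ext' (x := 1) (by simpa [ht] using hd) ht]
    simp
  -- A function vanishing on both branches has no linear term.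
  have both_t {f : MvPowerSeries (Fin 2) ℂ} (hf : MvPowerSeries.subst (powBranch ν) f = 0)
      (hf' : MvPowerSeries.subst (axisBranch s) f = 0) :
      MvPowerSeries.coeff (Finsupp.single t 1) f = 0 := by
    refine coeff_eq_zero_of_subst_powBranch hn hf _ fun d hd hne => ?_
    rw [hsum, hsum] at hd
    simp [hst] at hd
    by_cases ht : d t = 0
    · rw [ext' rfl ht]
      simpa using coeff_single_eq_zero_of_subst_axisBranch hf' (d s)
    · exfalso
      have h1 : a * 1 ≤ a * d t := Nat.mul_le_mul_left a (Nat.pos_of_ne_zero ht)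
      have h2 : d t = 1 := Nat.eq_of_mul_eq_mul_left (show 0 < a by omega) (by omega)
      apply hne
      rw [ext' (x := 0) (by omega) h2]
      simp
  have axis_s {f : MvPowerSeries (Fin 2) ℂ} (hf : MvPowerSeries.subst (axisBranch s) f = 0) :
      MvPowerSeries.coeff (Finsupp.single s 1) f = 0 :=
    coeff_single_eq_zero_of_subst_axisBranch hf 1
  obtain hc := exists_subst_eq_zero (hasSubst_powBranch hn) h2
    (by simp [powBranch, hνs, hνt]) he hFe
  obtain hl := exists_subst_eq_zero (hasSubst_axisBranch s) h1
    (by simp [axisBranch, hst]) he hFe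
  obtain ⟨rfl, rfl⟩ | ⟨rfl, rfl⟩ : (s = 0 ∧ t = 1) ∨ (s = 1 ∧ t = 0) := by omega
  all_goals
    rcases hc with hc | hc <;> rcases hl with hl | hl
    · simp [axis_s hl, both_t hc hl] at hJ
    · simp [curve_s hc, axis_s hl] at hJ
    · simp [curve_s hc, axis_s hl] at hJ
    · simp [axis_s hl, both_t hc hl] at hJ

/-- Three lines through a point do not cross normally. -/
lemma not_isNormalCrossing_of_lines {F : Poly} (h0 : X 0 ∣ F) (h1 : X 1 ∣ F)
    (h2 : X 0 - X 1 ∣ F) : ¬ IsNormalCrossing F := by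
  rintro ⟨e, s, t, m, n, he, -, -, hJ, hFe⟩
  have hn : ∀ i, (fun _ => 1 : Fin 2 → ℕ) i ≠ 0 := by simp
  have axis {i : Fin 2} {f : MvPowerSeries (Fin 2) ℂ}
      (hf : MvPowerSeries.subst (axisBranch i) f = 0) :
      MvPowerSeries.coeff (Finsupp.single i 1) f = 0 :=
    coeff_single_eq_zero_of_subst_axisBranch hf 1
  have diag {i : Fin 2} {f : MvPowerSeries (Fin 2) ℂ}
      (hf : MvPowerSeries.subst (powBranch fun _ => 1) f = 0)
      (hf' : MvPowerSeries.subst (axisBranch i) f = 0) (j : Fin 2) :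
      MvPowerSeries.coeff (Finsupp.single j 1) f = 0 := by
    by_cases hij : j = i
    · subst hij
      exact axis hf'
    · refine coeff_eq_zero_of_subst_powBranch hn hf _ fun d hd hne => ?_
      have hd' : d 0 + d 1 = 1 := by
        rw [one_mul, one_mul] at hd
        rw [hd]
        fin_cases j <;> simp
      have : d = Finsupp.single i 1 := by
        ext k
        by_contra hk
        apply hne
        ext l
        fin_cases i <;> fin_cases j <;> fin_cases k <;> fin_cases l <;> simp_all <;> omega
      rw [this]
      exact axis hf'
  obtain ha := exists_subst_eq_zero (hasSubst_axisBranch 1) h0 (by simp [axisBranch]) he hFe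
  obtain hb := exists_subst_eq_zero (hasSubst_axisBranch 0) h1 (by simp [axisBranch]) he hFe
  obtain hc := exists_subst_eq_zero (hasSubst_powBranch hn) h2 (by simp [powBranch]) he hFe
  rcases hc with hc | hc
  · rcases ha with ha | ha
    · simp [diag hc ha] at hJ
    · rcases hb with hb | hb
      · simp [diag hc hb] at hJ
      · simp [axis ha, axis hb] at hJ
  · rcases ha with ha | ha
    · rcases hb with hb | hb
      · simp [axis ha, axis hb] at hJ
      · simp [diag hc hb] at hJ
    · simp [diag hc ha] at hJ

/-! ### Determinants of weighted chains -/

@[simp] lemma chainDet_nil : chainDet [] = 1 := Matrix.det_fin_zero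

@[simp] lemma chainDet_singleton (x : ℤ) : chainDet [x] = x := by
  rw [chainDet]
  exact (Matrix.det_fin_one _).trans (by simp [chainMatrix])

lemma chainMatrix_cons_succ (x : ℤ) (l : List ℤ) (i j : Fin l.length) :
    chainMatrix (x :: l) i.succ j.succ = chainMatrix l i j := by
  simp [chainMatrix]

lemma chainDet_cons_cons (x y : ℤ) (l : List ℤ) :
    chainDet (x :: y :: l) = x * chainDet (y :: l) - chainDet l := by
  have h0 : (chainMatrix (x :: y :: l)).submatrix Fin.succ (Fin.succAbove 0) =
      chainMatrix (y :: l) := by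
    ext i j
    exact chainMatrix_cons_succ x (y :: l) i j
  have h1 : ((chainMatrix (x :: y :: l)).submatrix Fin.succ (Fin.succAbove 1)).det =
      chainDet l := by
    have hsub : ((chainMatrix (x :: y :: l)).submatrix Fin.succ (Fin.succAbove 1)).submatrix
        (Fin.succAbove 0) Fin.succ = chainMatrix l := by
      ext i j
      have : (Fin.succAbove (1 : Fin (l.length + 2)) j.succ) = j.succ.succ := by
        rw [← Fin.succ_zero_eq_one, Fin.succ_succAbove_succ]
        simp
      simp only [Matrix.submatrix_apply]
      rw [this, Fin.zero_succAbove]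
      exact (chainMatrix_cons_succ x (y :: l) i.succ j.succ).trans (chainMatrix_cons_succ y l i j)
    refine (Matrix.det_succ_column_zero (n := l.length) _).trans ?_
    rw [Fin.sum_univ_succ, Finset.sum_eq_zero]
    · rw [hsub]
      simp [chainMatrix, chainDet]
    · intro i _
      simp [chainMatrix, Fin.succAbove]
  rw [chainDet]
  refine (Matrix.det_succ_row_zero (n := l.length + 1) _).trans ?_
  rw [Fin.sum_univ_succ, Fin.sum_univ_succ, Finset.sum_eq_zero]
  · rw [h0, Fin.succ_zero_eq_one, h1]
    simp [chainMatrix, chainDet]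
    ring
  · intro i _
    simp [chainMatrix, Fin.ext_iff]

lemma chainDet_append_two : ∀ (l : List ℤ) (x y : ℤ),
    chainDet (l ++ [x, y]) = y * chainDet (l ++ [x]) - chainDet l
  | [], x, y => by
    simp [chainDet_cons_cons, mul_comm]
  | [z], x, y => by
    simp [chainDet_cons_cons]
    ring
  | z :: z' :: l, x, y => by
    have h1 := chainDet_append_two (z' :: l) x y
    have h2 := chainDet_append_two l x y
    simp only [List.cons_append, chainDet_cons_cons] at h1 h2 ⊢
    rw [h1, h2]
    ring

/-- The determinant of a weighted chain without its last vertex, `0` for the empty chain. -/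
def initDet (l : List ℤ) : ℤ := if l = [] then 0 else chainDet l.dropLast

/-- The determinant of a weighted chain without its first vertex, `0` for the empty chain. -/
def tailDet (l : List ℤ) : ℤ := if l = [] then 0 else chainDet l.tail

@[simp] lemma initDet_nil : initDet [] = 0 := rfl
@[simp] lemma tailDet_nil : tailDet [] = 0 := rfl
@[simp] lemma initDet_append_singleton (l : List ℤ) (x : ℤ) : initDet (l ++ [x]) = chainDet l := by
  simp [initDet]
@[simp] lemma tailDet_cons (x : ℤ) (l : List ℤ) : tailDet (x :: l) = chainDet l := by
  simp [tailDet]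

lemma chainDet_cons (x : ℤ) (l : List ℤ) : chainDet (x :: l) = x * chainDet l - tailDet l := by
  cases l with
  | nil => simp
  | cons y l => rw [chainDet_cons_cons, tailDet_cons]

lemma chainDet_append_singleton (l : List ℤ) (x : ℤ) :
    chainDet (l ++ [x]) = x * chainDet l - initDet l := by
  rcases List.eq_nil_or_concat' l with rfl | ⟨l, y, rfl⟩
  · simp
  · rw [List.append_assoc, initDet_append_singleton]
    exact chainDet_append_two l y x

/-! ### The additive algorithm of Euclid -/

/-- One step of the additive algorithm of Euclid, on pairs sorted in decreasing order. -/
def euclidStep (p : ℕ × ℕ) : ℕ × ℕ :=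
  if 2 * p.2 ≤ p.1 then (p.1 - p.2, p.2) else (p.2, p.1 - p.2)

/-- The pair `{a, b}`, sorted in decreasing order. -/
def sortPair (a b : ℕ) : ℕ × ℕ := (max a b, min a b)

lemma euclidStep_sortPair_of_lt {a b : ℕ} (h : b < a) :
    euclidStep (sortPair a b) = sortPair (a - b) b := by
  simp only [euclidStep, sortPair, max_eq_left h.le, min_eq_right h.le]
  split_ifs with h2 <;> ext <;> simp <;> omega

lemma sortPair_comm (a b : ℕ) : sortPair a b = sortPair b a := by
  simp [sortPair, max_comm, min_comm]

lemma euclidStep_sortPair_of_gt {a b : ℕ} (h : a < b) :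
    euclidStep (sortPair a b) = sortPair a (b - a) := by
  rw [sortPair_comm, euclidStep_sortPair_of_lt h, sortPair_comm]

lemma euclidSteps_of_lt {p : ℕ × ℕ} (h0 : 0 < p.2) (h : p.2 < p.1) :
    euclidSteps p.1 p.2 = euclidSteps (euclidStep p).1 (euclidStep p).2 + 1 := by
  rw [euclidSteps, dif_neg (by omega), euclidStep]
  split_ifs <;> rfl

lemma euclidSteps_self (a : ℕ) : euclidSteps a a = 0 := by
  rw [euclidSteps, dif_pos (by omega)]

/-! ### The graph -/

/-- The edge that starts in the vertex `s`. -/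
def edgeFrom (s : Quad) : Arrow :=
  if 2 * s.k₂ ≤ s.k₁ then ⟨s, .eps₁, ⟨s.k₁ - s.k₂, s.k₂, s.q₁ + s.q₂ - s.k₂, s.q₂⟩⟩
  else ⟨s, .eps₂, ⟨s.k₂, s.k₁ - s.k₂, s.q₂, s.q₁ + s.q₂ - s.k₂⟩⟩

@[simp] lemma edgeFrom_src (s : Quad) : (edgeFrom s).src = s := by
  rw [edgeFrom]
  split_ifs <;> rfl

lemma isEdge_edgeFrom {s : Quad} (hs : s ∈ setOD) : IsEdge (edgeFrom s) := by
  rw [edgeFrom]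
  split_ifs with h
  · exact ⟨hs, h, rfl⟩
  · exact ⟨hs, not_le.1 h, rfl⟩

lemma IsEdge.eq_edgeFrom {e : Arrow} (he : IsEdge e) : e = edgeFrom e.src := by
  obtain ⟨s, l, t⟩ := e
  obtain ⟨-, h⟩ := he
  cases l with
  | eps₁ =>
    obtain ⟨h1, h2⟩ := h
    dsimp only at h1 h2
    subst h2
    exact (if_pos h1).symm
  | eps₂ =>
    obtain ⟨h1, h2⟩ := h
    dsimp only at h1 h2
    subst h2
    exact (if_neg (not_le.2 h1)).symm

lemma root_notMem_setOD : root ∉ setOD := fun h => lt_irrefl _ h.1.2.2.1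

lemma edgeFrom_tgt_of_eq {s : Quad} (hs : s ∈ setOD) (h : s.k₁ = s.k₂) :
    (edgeFrom s).tgt = root := by
  obtain ⟨⟨h1, h2, h3, h4, h5, h6, h7⟩, -⟩ := hs
  have hk : s.k₁ = 1 := by
    have : s.k₁ * (s.k₁ - s.q₂ - s.q₁) = 1 := by rw [← h1, ← h]; ring
    exact Int.eq_one_of_dvd_one h2.le ⟨_, this.symm⟩
  have : ¬ 2 * s.k₂ ≤ s.k₁ := by omega
  rw [edgeFrom, if_neg this, root, Quad.mk.injEq]
  omega

lemma edgeFrom_tgt_mem {s : Quad} (hs : s ∈ setOD) (h : s.k₂ < s.k₁) :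
    (edgeFrom s).tgt ∈ setOD := by
  obtain ⟨⟨h1, h2, h3, h4, h5, h6, h7⟩, -⟩ := hs
  have hlo : 0 ≤ s.q₁ + s.q₂ - s.k₂ := by
    by_contra hn
    have h8 : s.k₁ * (s.q₁ + 1) ≤ s.k₁ * (s.k₂ - s.q₂) := by
      apply mul_le_mul_of_nonneg_left _ h2.le
      omega
    nlinarith [mul_nonneg h4 (sub_nonneg.2 h.le)]
  have hhi : s.q₁ + s.q₂ - s.k₂ < s.k₁ - s.k₂ := by
    by_contra hn
    have h8 : s.k₁ * (s.k₁ - s.q₁) ≤ s.k₁ * s.q₂ := by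
      apply mul_le_mul_of_nonneg_left _ h2.le
      omega
    nlinarith [mul_nonneg (sub_nonneg.2 h5.le) (sub_nonneg.2 h.le)]
  rw [edgeFrom]
  split_ifs with h2k
  · refine ⟨⟨?_, ?_, h3, hlo, hhi, h6, h7⟩, ?_⟩
    · linear_combination h1
    all_goals dsimp only; omega
  · refine ⟨⟨?_, h3, ?_, h6, h7, hlo, hhi⟩, ?_⟩
    · linear_combination h1
    all_goals dsimp only; omega

lemma pr_edgeFrom_tgt {s : Quad} {k : ℕ × ℕ} (hk : pr s = ((k.1 : ℤ), (k.2 : ℤ)))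
    (hle : k.2 ≤ k.1) :
    pr (edgeFrom s).tgt = (((euclidStep k).1 : ℤ), ((euclidStep k).2 : ℤ)) := by
  obtain ⟨h1, h2⟩ := Prod.mk.inj hk
  have : 2 * s.k₂ ≤ s.k₁ ↔ 2 * k.2 ≤ k.1 := by omega
  rw [edgeFrom, euclidStep]
  by_cases h : 2 * k.2 ≤ k.1
  · rw [if_pos h, if_pos (this.2 h)]
    ext <;> simp [pr] <;> omega
  · rw [if_neg h, if_neg (this.not.2 h)]
    ext <;> simp [pr] <;> omega

lemma isPath_root_iff {L : List Arrow} : IsPath root root L ↔ L = [] := by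
  constructor
  · intro h
    cases L with
    | nil => rfl
    | cons e L => exact (root_notMem_setOD (h.2.1 ▸ h.1.1)).elim
  · rintro rfl
    exact ⟨rfl, Or.inr rfl⟩

lemma isPath_iff_of_mem {s : Quad} (hs : s ∈ setOD) {L : List Arrow} :
    IsPath s root L ↔ ∃ L', L = edgeFrom s :: L' ∧ IsPath (edgeFrom s).tgt root L' := by
  constructor
  · intro h
    cases L with
    | nil => exact (root_notMem_setOD (h.1 ▸ hs)).elim
    | cons e L =>
      obtain ⟨h1, rfl, h3⟩ := h
      have := h1.eq_edgeFrom
      exact ⟨L, by rw [← this], by rwa [← this]⟩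
  · rintro ⟨L', rfl, h⟩
    exact ⟨isEdge_edgeFrom hs, edgeFrom_src s, h⟩

/-- The path from a vertex to the root follows the algorithm of Euclid. -/
lemma exists_path {s : Quad} (hs : s ∈ setOD) {k : ℕ × ℕ}
    (hk : pr s = ((k.1 : ℤ), (k.2 : ℤ))) :
    ∃ L, (∀ L', IsPath s root L' ↔ L' = L) ∧ L.length = euclidSteps k.1 k.2 + 1 ∧
      ∀ i e, L[i]? = some e → IsEdge e ∧
        pr e.src = (((euclidStep^[i] k).1 : ℤ), ((euclidStep^[i] k).2 : ℤ)) := by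
  induction hn : k.1 using Nat.strong_induction_on generalizing s k with
  | _ n ih =>
    subst hn
    obtain ⟨hk1, hk2⟩ := Prod.mk.inj hk
    have hpos := hs.1.2.2.1
    have hle := hs.2
    rcases hle.eq_or_lt with heq | hlt
    · refine ⟨[edgeFrom s], fun L' => ?_, ?_, ?_⟩
      · rw [isPath_iff_of_mem hs, edgeFrom_tgt_of_eq hs heq.symm]
        simp [isPath_root_iff]
      · have : k.1 = k.2 := by omega
        simp [this, euclidSteps_self]
      · intro i e he
        obtain rfl : i = 0 := by
          have := (List.getElem?_eq_some_iff.1 he).1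
          simpa using this
        obtain rfl : edgeFrom s = e := by simpa using he
        exact ⟨isEdge_edgeFrom hs, by simpa using hk⟩
    · have hlt' : (euclidStep k).1 < k.1 := by
        rw [euclidStep]
        split_ifs <;> dsimp only <;> omega
      obtain ⟨L, h1, h2, h3⟩ := ih _ hlt' (edgeFrom_tgt_mem hs hlt)
        (pr_edgeFrom_tgt hk (by omega)) rfl
      refine ⟨edgeFrom s :: L, fun L' => ?_, ?_, ?_⟩
      · rw [isPath_iff_of_mem hs]
        simp [h1]
      · rw [List.length_cons, h2, euclidSteps_of_lt (p := k) (by omega) (by omega)]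
      · intro i e he
        cases i with
        | zero =>
          obtain rfl : edgeFrom s = e := by simpa using he
          exact ⟨isEdge_edgeFrom hs, by simpa using hk⟩
        | succ i =>
          rw [List.getElem?_cons_succ] at he
          simpa using h3 i e he

/-- The elements of `O_D` are determined by their projections. -/
lemma eq_of_mem_setOD {s t : Quad} (hs : s ∈ setOD) (ht : t ∈ setOD) (h : pr s = pr t) :
    s = t := by
  obtain ⟨⟨s1, s2, s3, s4, s5, s6, s7⟩, -⟩ := hs
  obtain ⟨⟨t1, t2, t3, t4, t5, t6, t7⟩, -⟩ := ht
  obtain ⟨e1, e2⟩ := Prod.mk.inj h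
  rw [← e1] at t1 t5
  rw [← e2] at t1 t7
  have hdiff : s.k₁ * (s.q₂ - t.q₂) + s.k₂ * (s.q₁ - t.q₁) = 0 := by linear_combination t1 - s1
  have hcop : IsCoprime s.k₁ s.k₂ := ⟨s.k₂ - s.q₂, -s.q₁, by linear_combination s1⟩
  have hdvd : s.k₂ ∣ s.q₂ - t.q₂ :=
    hcop.symm.dvd_of_dvd_mul_left ⟨-(s.q₁ - t.q₁), by linear_combination hdiff⟩
  have h2 : s.q₂ - t.q₂ = 0 :=
    Int.eq_zero_of_abs_lt_dvd hdvd (abs_lt.2 ⟨by omega, by omega⟩)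
  rw [h2, mul_zero, zero_add, mul_eq_zero] at hdiff
  ext
  · exact e1
  · exact e2
  · rcases hdiff with h' | h'
    · omega
    · omega
  · omega

/-! ### The centres prescribed by the algorithm of Euclid -/

/-- The sequences of centres in the resolution of `x ^ k₁ = y ^ k₂`. The curve at the centre `w` is
`u ^ a = v ^ b`, and the next centre is the point of the exceptional line on its proper transform.
The lists `P` and `Q` are the numbers of the exceptional curves on either side of `w`, in the order
of the dual graph: the last curve of `P` is `u = 0` and the first curve of `Q` is `v = 0`. -/
inductive EuclidPath (k₁ k₂ : ℕ) : NearPoint → ℕ → ℕ → List ℕ → List ℕ → Prop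
  | nil : EuclidPath k₁ k₂ [] k₁ k₂ [] []
  | zero {w a b P Q} : EuclidPath k₁ k₂ w a b P Q → b < a →
      EuclidPath k₁ k₂ (w ++ [((0 : ℂ) : OnePoint ℂ)]) (a - b) b (P ++ [w.length]) Q
  | infty {w a b P Q} : EuclidPath k₁ k₂ w a b P Q → a < b →
      EuclidPath k₁ k₂ (w ++ [∞]) a (b - a) P (w.length :: Q)

namespace EuclidPath

variable {k₁ k₂ : ℕ} {w : NearPoint} {a b : ℕ} {P Q : List ℕ}

lemma pos_and_coprime (h : EuclidPath k₁ k₂ w a b P Q) (h₁ : 0 < k₁) (h₂ : 0 < k₂)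
    (hc : k₁.Coprime k₂) : 0 < a ∧ 0 < b ∧ a.Coprime b := by
  induction h with
  | nil => exact ⟨h₁, h₂, hc⟩
  | zero _ hlt ih => exact ⟨by omega, ih.2.1, (Nat.coprime_sub_self_left hlt.le).2 ih.2.2⟩
  | infty _ hlt ih => exact ⟨ih.1, by omega, (Nat.coprime_sub_self_right hlt.le).2 ih.2.2⟩

lemma sortPair_eq (h : EuclidPath k₁ k₂ w a b P Q) :
    sortPair a b = euclidStep^[w.length] (sortPair k₁ k₂) := by
  induction h with
  | nil => rfl
  | zero _ hlt ih =>
    rw [List.length_append, List.length_singleton, Function.iterate_succ_apply', ← ih,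
      euclidStep_sortPair_of_lt hlt]
  | infty _ hlt ih =>
    rw [List.length_append, List.length_singleton, Function.iterate_succ_apply', ← ih,
      euclidStep_sortPair_of_gt hlt]

lemma euclidSteps_eq (h : EuclidPath k₁ k₂ w a b P Q) (h₁ : 0 < k₁) (h₂ : 0 < k₂)
    (hc : k₁.Coprime k₂) : euclidSteps (sortPair k₁ k₂).1 (sortPair k₁ k₂).2 =
      w.length + euclidSteps (sortPair a b).1 (sortPair a b).2 := by
  induction h with
  | nil => simp
  | zero h hlt ih =>
    have := h.pos_and_coprime h₁ h₂ hc
    rw [ih, euclidSteps_of_lt (by simp [sortPair]; omega) (by simp [sortPair]; omega),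
      euclidStep_sortPair_of_lt hlt]
    simp
    omega
  | infty h hlt ih =>
    have := h.pos_and_coprime h₁ h₂ hc
    rw [ih, euclidSteps_of_lt (by simp [sortPair]; omega) (by simp [sortPair]; omega),
      euclidStep_sortPair_of_gt hlt]
    simp
    omega

/-- The algorithm ends at the pair `(1, 1)`. -/
lemma exists_extend (h : EuclidPath k₁ k₂ w a b P Q) (h₁ : 0 < k₁) (h₂ : 0 < k₂)
    (hc : k₁.Coprime k₂) : ∃ cs P' Q', EuclidPath k₁ k₂ cs 1 1 P' Q' := by
  induction hn : a + b using Nat.strong_induction_on generalizing w a b P Q with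
  | _ n ih =>
    subst hn
    obtain ⟨ha, hb, hab⟩ := h.pos_and_coprime h₁ h₂ hc
    rcases lt_trichotomy a b with hlt | rfl | hlt
    · exact ih _ (by omega) (h.infty hlt) rfl
    · obtain rfl : a = 1 := by simpa using hab
      exact ⟨_, _, _, h⟩
    · exact ih _ (by omega) (h.zero hlt) rfl

/-- The sequence before each of its centres. -/
lemma take (h : EuclidPath k₁ k₂ w a b P Q) {j : ℕ} (hj : j < w.length) :
    ∃ a' b' P' Q', EuclidPath k₁ k₂ (w.take j) a' b' P' Q' ∧
      ((b' < a' ∧ w[j] = ((0 : ℂ) : OnePoint ℂ)) ∨ (a' < b' ∧ w[j] = ∞)) := by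
  induction h with
  | nil => simp at hj
  | @zero w a b P Q h hlt ih =>
    rcases Nat.lt_or_ge j w.length with hj' | hj'
    · obtain ⟨a', b', P', Q', h1, h2⟩ := ih hj'
      rw [List.take_append_of_le_length hj'.le, List.getElem_append_left hj']
      exact ⟨a', b', P', Q', h1, h2⟩
    · obtain rfl : j = w.length := by simp at hj; omega
      exact ⟨a, b, P, Q, by simpa using h, Or.inl ⟨hlt, by simp⟩⟩
  | @infty w a b P Q h hlt ih =>
    rcases Nat.lt_or_ge j w.length with hj' | hj'
    · obtain ⟨a', b', P', Q', h1, h2⟩ := ih hj'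
      rw [List.take_append_of_le_length hj'.le, List.getElem_append_left hj']
      exact ⟨a', b', P', Q', h1, h2⟩
    · obtain rfl : j = w.length := by simp at hj; omega
      exact ⟨a, b, P, Q, by simpa using h, Or.inr ⟨hlt, by simp⟩⟩

lemma exists_take (h : EuclidPath k₁ k₂ w a b P Q) {j : ℕ} (hj : j ≤ w.length) :
    ∃ a' b' P' Q', EuclidPath k₁ k₂ (w.take j) a' b' P' Q' := by
  rcases hj.lt_or_eq with hj | rfl
  · obtain ⟨a', b', P', Q', h', -⟩ := h.take hj
    exact ⟨_, _, _, _, h'⟩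
  · exact ⟨_, _, _, _, by simpa using h⟩

/-! ### The curve and its total transform -/

lemma not_X_dvd_curveB {a b : ℕ} (ha : 0 < a) (hb : 0 < b) (s : Fin 2) :
    ¬ X s ∣ (X 0 ^ a - X 1 ^ b : Poly) := by
  rw [X_dvd_iff_restrict_eq_zero]
  fin_cases s
  · simp [restrict, ha.ne']
  · simp [restrict, hb.ne']

lemma pull_zero_sub (h : b < a) :
    pull ((0 : ℂ) : OnePoint ℂ) (X 0 ^ a - X 1 ^ b) = X 0 ^ b * (X 0 ^ (a - b) - X 1 ^ b) := by
  simp only [pull_eq, map_sub, map_pow, pullHom_coe_X_zero, pullHom_coe_X_one, map_zero, add_zero]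
  conv_lhs => rw [← Nat.add_sub_cancel' h.le, pow_add]
  ring

lemma pull_infty_sub (h : a < b) :
    pull ∞ (X 0 ^ a - X 1 ^ b) = X 1 ^ a * (X 0 ^ a - X 1 ^ (b - a)) := by
  simp only [pull_eq, map_sub, map_pow, pullHom_infty_X_zero, pullHom_infty_X_one]
  conv_lhs => rw [← Nat.add_sub_cancel' h.le, pow_add]
  ring

lemma proper_curveB (h : EuclidPath k₁ k₂ w a b P Q) (h₁ : 0 < k₁) (h₂ : 0 < k₂)
    (hc : k₁.Coprime k₂) : proper (curveB k₁ k₂) w = X 0 ^ a - X 1 ^ b := by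
  induction h with
  | nil => rfl
  | zero h hlt ih =>
    have := h.pos_and_coprime h₁ h₂ hc
    rw [proper_append_singleton, ih]
    exact properTransform_eq _ (pull_zero_sub hlt)
      (not_X_dvd_curveB (by omega) (by omega) _)
  | infty h hlt ih =>
    have := h.pos_and_coprime h₁ h₂ hc
    rw [proper_append_singleton, ih]
    exact properTransform_eq _ (pull_infty_sub hlt)
      (not_X_dvd_curveB (by omega) (by omega) _)

/-- The total transform of the germ at a centre, and the conditions on the exponents that prevent
normal crossings. They hold at the origin unless `k₁ = k₂ = 1`, when the origin is the only
centre. -/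
lemma exists_total_germ (h : EuclidPath k₁ k₂ w a b P Q) (h₁ : 0 < k₁) (h₂ : 0 < k₂)
    (hle : k₂ ≤ k₁) :
    ∃ p q, total (germ k₁ k₂) w = X 0 ^ p * X 1 ^ q * (X 0 ^ a - X 1 ^ b) ∧
      ((k₁ = 1 ∧ k₂ = 1 ∧ a = 1 ∧ b = 1 ∧ w = []) ∨ ((1 ≤ p ∨ 2 ≤ a) ∧ (1 ≤ q ∨ 2 ≤ b))) := by
  induction h with
  | nil =>
    by_cases hk : k₂ = 1 ∧ 2 ≤ k₁
    · exact ⟨0, 1, by simp [germ, hk, curveB, mul_comm], Or.inr ⟨Or.inr hk.2, Or.inl le_rfl⟩⟩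
    · exact ⟨0, 0, by simp [germ, hk, curveB], by simp; omega⟩
  | @zero w a b P Q h hlt ih =>
    obtain ⟨p, q, ht, hpq⟩ := ih
    refine ⟨p + q + b, q, ?_, Or.inr ?_⟩
    · have := pull_zero_sub hlt
      rw [pull_eq] at this
      rw [total_append_singleton, ht, pull_eq, map_mul, map_mul, map_pow, map_pow, this]
      simp only [pullHom_coe_X_zero, pullHom_coe_X_one, map_zero, add_zero]
      ring
    · have hb : 0 < b ∨ 1 ≤ q := by omega
      omega
  | @infty w a b P Q h hlt ih =>
    obtain ⟨p, q, ht, hpq⟩ := ih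
    refine ⟨p, p + q + a, ?_, Or.inr ?_⟩
    · have := pull_infty_sub hlt
      rw [pull_eq] at this
      rw [total_append_singleton, ht, pull_eq, map_mul, map_mul, map_pow, map_pow, this]
      simp only [pullHom_infty_X_zero, pullHom_infty_X_one]
      ring
    · omega

lemma not_isNormalCrossing (h : EuclidPath k₁ k₂ w a b P Q) (h₁ : 0 < k₁) (h₂ : 0 < k₂)
    (hle : k₂ ≤ k₁) (hc : k₁.Coprime k₂) (hw : w ≠ []) :
    ¬ IsNormalCrossing (total (germ k₁ k₂) w) := by
  obtain ⟨ha, hb, hab⟩ := h.pos_and_coprime h₁ h₂ hc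
  obtain ⟨p, q, ht, hpq⟩ := h.exists_total_germ h₁ h₂ hle
  have hpq' : (1 ≤ p ∨ 2 ≤ a) ∧ (1 ≤ q ∨ 2 ≤ b) := by tauto
  obtain ⟨hp, hq⟩ := hpq'
  have hd0 (hp : 1 ≤ p) : X 0 ∣ total (germ k₁ k₂) w := by
    rw [ht]
    exact ((dvd_pow_self _ (by omega)).mul_right _).mul_right _
  have hd1 (hq : 1 ≤ q) : X 1 ∣ total (germ k₁ k₂) w := by
    rw [ht]
    exact ((dvd_pow_self _ (by omega)).mul_left _).mul_right _
  have hd : X 0 ^ a - X 1 ^ b ∣ total (germ k₁ k₂) w := ⟨_, ht.trans (mul_comm _ _)⟩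
  rcases Nat.lt_or_ge a 2 with ha2 | ha2 <;> rcases Nat.lt_or_ge b 2 with hb2 | hb2
  · obtain rfl : a = 1 := by omega
    obtain rfl : b = 1 := by omega
    exact not_isNormalCrossing_of_lines (hd0 (by omega)) (hd1 (by omega)) (by simpa using hd)
  · obtain rfl : a = 1 := by omega
    refine not_isNormalCrossing_of_tangent hb2 (s := 1) (t := 0) (by simp) (hd0 (by omega)) ?_
    rw [← neg_dvd]
    simpa using hd
  · obtain rfl : b = 1 := by omega
    exact not_isNormalCrossing_of_tangent ha2 (s := 0) (t := 1) (by simp) (hd1 (by omega))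
      (by simpa using hd)
  · exact not_isNormalCrossing_of_cusp ha2 hb2 hab hd

/-- Away from the next centre, the total transform has normal crossings. -/
lemma isNormalCrossing_append (h : EuclidPath k₁ k₂ w a b P Q) (h₁ : 0 < k₁) (h₂ : 0 < k₂)
    (hle : k₂ ≤ k₁) (hc : k₁.Coprime k₂) {z : OnePoint ℂ}
    (hz0 : b < a → z ≠ ((0 : ℂ) : OnePoint ℂ)) (hzi : a < b → z ≠ ∞) :
    IsNormalCrossing (total (germ k₁ k₂) (w ++ [z])) := by
  obtain ⟨ha, hb, hab⟩ := h.pos_and_coprime h₁ h₂ hc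
  obtain ⟨p, q, ht, -⟩ := h.exists_total_germ h₁ h₂ hle
  rw [total_append_singleton, ht, pull_eq, map_mul, map_mul, map_sub, map_pow, map_pow, map_pow,
    map_pow]
  rcases lt_trichotomy a b with hlt | rfl | hlt
  · obtain ⟨d, rfl⟩ := Nat.exists_eq_add_of_lt hlt
    cases z with
    | infty => exact (hzi hlt rfl).elim
    | coe c =>
      simp only [pullHom_coe_X_zero, pullHom_coe_X_one, mul_pow]
      by_cases hc0 : c = 0
      · refine isNormalCrossing_of_eq (p + q + a) q
          (g := 1 - X 0 ^ (d + 1) * (X 1 + C c) ^ (a + d + 1)) ?_ (by simp)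
        simp only [hc0, map_zero, add_zero]
        ring
      · refine isNormalCrossing_of_eq (p + q + a) 0
          (g := (X 1 + C c) ^ q * (1 - X 0 ^ (d + 1) * (X 1 + C c) ^ (a + d + 1))) ?_
          (by simp [hc0])
        ring
  · obtain rfl : a = 1 := by simpa using hab
    cases z with
    | infty =>
      simp only [pullHom_infty_X_zero, pullHom_infty_X_one]
      exact isNormalCrossing_of_eq p (p + q + 1) (g := X 0 - 1) (by ring) (by simp)
    | coe c =>
      simp only [pullHom_coe_X_zero, pullHom_coe_X_one, mul_pow]
      by_cases hc0 : c = 0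
      · refine isNormalCrossing_of_eq (p + q + 1) q (g := 1 - X 1) ?_ (by simp)
        simp only [hc0, map_zero, add_zero]
        ring
      by_cases hc1 : c = 1
      · refine isNormalCrossing_of_eq (p + q + 1) 1 (g := -(X 1 + C c) ^ q) ?_ (by simp [hc1])
        simp only [hc1, map_one]
        ring
      · refine isNormalCrossing_of_eq (p + q + 1) 0 (g := (X 1 + C c) ^ q * (1 - (X 1 + C c)))
          (by ring) ?_
        simpa [hc0, sub_eq_zero] using Ne.symm hc1
  · obtain ⟨d, rfl⟩ := Nat.exists_eq_add_of_lt hlt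
    cases z with
    | infty =>
      simp only [pullHom_infty_X_zero, pullHom_infty_X_one]
      refine isNormalCrossing_of_eq p (p + q + b) (g := X 0 ^ (b + d + 1) * X 1 ^ (d + 1) - 1)
        (by ring) (by simp)
    | coe c =>
      have hc0 : c ≠ 0 := by
        rintro rfl
        exact hz0 hlt rfl
      simp only [pullHom_coe_X_zero, pullHom_coe_X_one, mul_pow]
      refine isNormalCrossing_of_eq (p + q + b) 0
        (g := (X 1 + C c) ^ q * (X 0 ^ (d + 1) - (X 1 + C c) ^ b)) (by ring) ?_
      simp [hc0]

end EuclidPath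

/-- The centres of the algorithm of Euclid give the only resolution: the total
transform has no normal crossings there, so that each of them has to be blown up, and it has normal
crossings at all other points. -/
lemma resolves_iff {k₁ k₂ : ℕ} {cs : NearPoint} {P Q : List ℕ} (h : EuclidPath k₁ k₂ cs 1 1 P Q)
    (h₁ : 0 < k₁) (h₂ : 0 < k₂) (hle : k₂ ≤ k₁) (hc : k₁.Coprime k₂) (cs' : NearPoint) :
    Resolves (germ k₁ k₂) cs' ↔ cs' = cs := by
  have hnc : HasNormalCrossings (germ k₁ k₂) cs := by
    intro w hw
    obtain ⟨v, z, rfl⟩ := exists_append_of_mem_pointsOver hw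
    obtain ⟨hv, hvz⟩ := append_mem_pointsOver.1 hw
    obtain ⟨j, hj, rfl⟩ : ∃ j ≤ cs.length, v = cs.take j :=
      ⟨v.length, hv.length_le, List.prefix_iff_eq_take.1 hv⟩
    rcases hj.lt_or_eq with hj | rfl
    · obtain ⟨a, b, P', Q', h', hcase⟩ := h.take hj
      have hne : z ≠ cs[j] := by
        rintro rfl
        rw [List.take_append_getElem] at hvz
        exact hvz (List.take_prefix _ _)
      refine h'.isNormalCrossing_append h₁ h₂ hle hc (fun hlt => ?_) fun hlt => ?_
      · rcases hcase with hcase | hcase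
        · rwa [← hcase.2]
        · omega
      · rcases hcase with hcase | hcase
        · omega
        · rwa [← hcase.2]
    · rw [List.take_length]
      exact h.isNormalCrossing_append h₁ h₂ hle hc (fun h => by omega) fun h => by omega
  have hpre (cs') (h' : HasNormalCrossings (germ k₁ k₂) cs') : cs <+: cs' := by
    suffices ∀ j ≤ cs.length, cs.take j <+: cs' by simpa using this _ le_rfl
    intro j hj
    induction j with
    | zero => simp
    | succ j ih =>
      by_contra hn
      have hjl : j < cs.length := hj
      obtain ⟨a, b, P', Q', ht⟩ := h.exists_take hj
      refine ht.not_isNormalCrossing h₁ h₂ hle hc ?_ (h' _ ?_)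
      · intro h0
        have := congrArg List.length h0
        simp at this
        simp [this] at hjl
      · rw [← List.take_append_getElem hjl] at hn ⊢
        exact append_mem_pointsOver.2 ⟨ih hjl.le, hn⟩
  constructor
  · rintro ⟨h1, h2⟩
    have := h2 cs hnc
    simp only [numBlowups] at this
    exact ((hpre cs' h1).eq_of_length_le (by omega)).symm
  · rintro rfl
    refine ⟨hnc, fun cs'' h'' => ?_⟩
    have := (hpre cs'' h'').length_le
    simp only [numBlowups]
    omega

/-! ### The dual graph of the exceptional curves -/

/-- The list `l` is a linear chain for the intersection form `I`. -/
def IsChainFor (I : ℕ → ℕ → ℕ) (l : List ℕ) : Prop :=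
  ∀ i j (hi : i < l.length) (hj : j < l.length), i < j →
    I l[i] l[j] = if j = i + 1 then 1 else 0

/-- Insertion of a vertex into an edge of a linear chain, or at its end. -/
lemma IsChainFor.insert {I I' : ℕ → ℕ → ℕ} {P Q : List ℕ} {m : ℕ} (h : IsChainFor I (P ++ Q))
    (hPP : ∀ x ∈ P, ∀ y ∈ P, x ≠ y → I' x y = I x y)
    (hQQ : ∀ x ∈ Q, ∀ y ∈ Q, x ≠ y → I' x y = I x y)
    (hnd : (P ++ Q).Nodup)
    (hPQ : ∀ x ∈ P, ∀ y ∈ Q, I' x y = 0)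
    (hPm : ∀ i (hi : i < P.length), I' P[i] m = if i + 1 = P.length then 1 else 0)
    (hQm : ∀ j (hj : j < Q.length), I' m Q[j] = if j = 0 then 1 else 0) :
    IsChainFor I' (P ++ m :: Q) := by
  have hndP : P.Nodup := hnd.of_append_left
  have hndQ : Q.Nodup := hnd.of_append_right
  intro i j hi hj hij
  have hjl : j < P.length + (Q.length + 1) := by simpa using hj
  rcases lt_trichotomy i P.length with hiP | rfl | hiP
  · rcases lt_trichotomy j P.length with hjP | rfl | hjP
    · rw [List.getElem_append_left hiP, List.getElem_append_left hjP,
        hPP _ (List.getElem_mem hiP) _ (List.getElem_mem hjP)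
          (fun he => hij.ne (hndP.getElem_inj_iff.1 he))]
      have := h i j (by simp; omega) (by simp; omega) hij
      rwa [List.getElem_append_left hiP, List.getElem_append_left hjP] at this
    · rw [List.getElem_append_left hiP, List.getElem_append_right le_rfl]
      simp only [Nat.sub_self, List.getElem_cons_zero]
      rw [hPm i hiP]
      simp only [eq_comm]
    · obtain ⟨k, rfl⟩ := Nat.exists_eq_add_of_lt hjP
      rw [List.getElem_append_left hiP, List.getElem_append_right (by omega), if_neg (by omega)]
      have : P.length + k + 1 - P.length = k + 1 := by omega
      simp only [this, List.getElem_cons_succ]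
      exact hPQ _ (List.getElem_mem _) _ (List.getElem_mem _)
  · obtain ⟨k, rfl⟩ := Nat.exists_eq_add_of_lt hij
    rw [List.getElem_append_right le_rfl, List.getElem_append_right (by omega)]
    have : P.length + k + 1 - P.length = k + 1 := by omega
    simp only [this, List.getElem_cons_succ, Nat.sub_self, List.getElem_cons_zero]
    rw [hQm]
    simp
  · obtain ⟨k, rfl⟩ := Nat.exists_eq_add_of_lt hiP
    obtain ⟨l, rfl⟩ := Nat.exists_eq_add_of_lt hij
    rw [List.getElem_append_right (by omega), List.getElem_append_right (by omega)]
    have e1 : P.length + k + 1 - P.length = k + 1 := by omega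
    have e2 : P.length + k + 1 + l + 1 - P.length = k + l + 1 + 1 := by omega
    simp only [e1, e2, List.getElem_cons_succ]
    rw [hQQ _ (List.getElem_mem _) _ (List.getElem_mem _)
      (fun he => by have := hndQ.getElem_inj_iff.1 he; omega)]
    have := h (P.length + k) (P.length + (k + l + 1)) (by simp; omega) (by simp; omega) (by omega)
    rw [List.getElem_append_right (by omega), List.getElem_append_right (by omega)] at this
    simp only [Nat.add_sub_cancel_left] at this
    rw [this]
    congr 1
    simp
    omega

/-- The exceptional curves before the blowup with centre `w`: they form the linear chain `P ++ Q`,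
and only the last curve of `P` (the axis `X 0 = 0`) and the first curve of `Q` (the axis `X 1 = 0`)
pass through `w`. -/
structure ExcState (w : NearPoint) (P Q : List ℕ) : Prop where
  perm : (P ++ Q).Perm (List.range w.length)
  chain : IsChainFor (interNumber w.dropLast) (P ++ Q)
  left : ∀ i, P.getLast? = some i → curveEq i w = X 0
  right : ∀ i, Q.head? = some i → curveEq i w = X 1
  on : ∀ i, OnCurve i w → P.getLast? = some i ∨ Q.head? = some i

namespace ExcState

variable {w : NearPoint} {P Q : List ℕ}

lemma nodup (h : ExcState w P Q) : (P ++ Q).Nodup := h.perm.nodup_iff.2 List.nodup_range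

lemma lt_of_mem (h : ExcState w P Q) {i : ℕ} (hi : i ∈ P ++ Q) : i < w.length :=
  List.mem_range.1 (h.perm.mem_iff.1 hi)

lemma ne_of_mem (h : ExcState w P Q) {i j : ℕ} (hi : i ∈ P) (hj : j ∈ Q) : i ≠ j :=
  (List.nodup_append.1 h.nodup).2.2 i hi j hj

lemma onCurve_left_iff (h : ExcState w P Q) {i : ℕ} (hi : i ∈ P) :
    OnCurve i w ↔ P.getLast? = some i := by
  constructor
  · intro hon
    refine (h.on i hon).resolve_right fun hQ => ?_
    exact h.ne_of_mem hi (List.mem_of_head? hQ) rfl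
  · intro hl
    simp [OnCurve, h.left i hl]

lemma onCurve_right_iff (h : ExcState w P Q) {i : ℕ} (hi : i ∈ Q) :
    OnCurve i w ↔ Q.head? = some i := by
  constructor
  · intro hon
    refine (h.on i hon).resolve_left fun hP => ?_
    exact h.ne_of_mem (List.mem_of_getLast? hP) hi rfl
  · intro hl
    simp [OnCurve, h.right i hl]

/-- The blowup of `w` inserts the new curve between `P` and `Q`. -/
lemma isChainFor_append_cons (h : ExcState w P Q) :
    IsChainFor (interNumber w) (P ++ w.length :: Q) := by
  classical
  rcases List.eq_nil_or_concat' w with rfl | ⟨v, z, rfl⟩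
  · have := h.perm.eq_nil
    obtain ⟨rfl, rfl⟩ := List.append_eq_nil_iff.1 this
    intro i j hi hj hij
    simp at hj
    omega
  set w : NearPoint := v ++ [z] with hw
  have hlen : w.length = v.length + 1 := by simp [hw]
  have hdrop : w.dropLast = v := by simp [hw]
  have hchain := h.chain
  rw [hdrop] at hchain
  have key {i j : ℕ} (hi : i < w.length) (hj : j < w.length) (hij : i ≠ j) :
      interNumber w i j + (if OnCurve i w ∧ OnCurve j w then 1 else 0) = interNumber v i j := by
    rcases hij.lt_or_gt with hlt | hlt
    · exact interNumber_append z hlt (by omega)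
    · rw [interNumber_comm w, interNumber_comm v]
      simpa only [and_comm] using interNumber_append z hlt (by omega)
  refine hchain.insert ?_ ?_ h.nodup ?_ ?_ ?_
  · intro x hx y hy hxy
    have := key (h.lt_of_mem (List.mem_append_left _ hx)) (h.lt_of_mem (List.mem_append_left _ hy))
      hxy
    rw [if_neg, add_zero] at this
    · exact this
    · rw [h.onCurve_left_iff hx, h.onCurve_left_iff hy]
      rintro ⟨h1, h2⟩
      rw [h1] at h2
      exact hxy (Option.some.inj h2)
  · intro x hx y hy hxy
    have := key (h.lt_of_mem (List.mem_append_right _ hx))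
      (h.lt_of_mem (List.mem_append_right _ hy)) hxy
    rw [if_neg, add_zero] at this
    · exact this
    · rw [h.onCurve_right_iff hx, h.onCurve_right_iff hy]
      rintro ⟨h1, h2⟩
      rw [h1] at h2
      exact hxy (Option.some.inj h2)
  · intro x hx y hy
    have := key (h.lt_of_mem (List.mem_append_left _ hx))
      (h.lt_of_mem (List.mem_append_right _ hy)) (h.ne_of_mem hx hy)
    obtain ⟨i, hi, rfl⟩ := List.getElem_of_mem hx
    obtain ⟨j, hj, rfl⟩ := List.getElem_of_mem hy
    have hc := hchain i (P.length + j) (by simp; omega) (by simp; omega) (by omega)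
    rw [List.getElem_append_left hi, List.getElem_append_right (by omega)] at hc
    simp only [Nat.add_sub_cancel_left] at hc
    rw [hc, h.onCurve_left_iff hx, h.onCurve_right_iff hy] at this
    by_cases hadj : P.length + j = i + 1
    · have hj0 : j = 0 := by omega
      have hi0 : i = P.length - 1 := by omega
      subst hj0 hi0
      rw [if_pos hadj, if_pos] at this
      · omega
      · constructor
        · rw [List.getLast?_eq_getElem?, List.getElem?_eq_getElem]
        · rw [List.head?_eq_getElem?, List.getElem?_eq_getElem]
    · rw [if_neg hadj] at this
      omega
  · intro i hi
    rw [interNumber_length (h.lt_of_mem (List.mem_append_left _ (List.getElem_mem hi)))]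
    congr 1
    rw [h.onCurve_left_iff (List.getElem_mem hi), List.getLast?_eq_getElem?,
      List.getElem?_eq_getElem (by omega), Option.some_inj,
      (List.Nodup.of_append_left h.nodup).getElem_inj_iff, eq_iff_iff]
    omega
  · intro j hj
    rw [interNumber_comm, interNumber_length
      (h.lt_of_mem (List.mem_append_right _ (List.getElem_mem hj)))]
    congr 1
    rw [h.onCurve_right_iff (List.getElem_mem hj), List.head?_eq_getElem?,
      List.getElem?_eq_getElem (by omega), Option.some_inj,
      (List.Nodup.of_append_right h.nodup).getElem_inj_iff, eq_iff_iff]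
    omega

lemma perm_append_cons (h : ExcState w P Q) :
    (P ++ w.length :: Q).Perm (List.range (w.length + 1)) := by
  rw [List.range_succ]
  exact List.perm_middle.trans ((h.perm.cons _).trans (List.perm_append_singleton _ _).symm)

lemma nil : ExcState [] [] [] where
  perm := by simp
  chain := by
    intro i j hi
    simp at hi
  left := by simp
  right := by simp
  on i hi := (not_onCurve_of_length_le (by simp) hi).elim

lemma append_zero (h : ExcState w P Q) :
    ExcState (w ++ [((0 : ℂ) : OnePoint ℂ)]) (P ++ [w.length]) Q where
  perm := by simpa using h.perm_append_cons
  chain := by simpa using h.isChainFor_append_cons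
  left i hi := by
    obtain rfl : w.length = i := by simpa using hi
    simp
  right i hi := by
    have := h.lt_of_mem (List.mem_append_right _ (List.mem_of_head? hi))
    exact curveEq_append_axisPoint (s := 1) this (h.right i hi)
  on i hi := by
    have hlt := lt_length_of_onCurve hi
    rw [List.length_append, List.length_singleton, Nat.lt_succ_iff_lt_or_eq] at hlt
    rcases hlt with hlt | rfl
    · right
      refine (h.on i (onCurve_of_append hlt hi)).resolve_left fun hl => ?_
      have := (onCurve_append_iff hlt (h.left i hl) _).1 hi
      simp at this
    · simp

lemma append_infty (h : ExcState w P Q) : ExcState (w ++ [∞]) P (w.length :: Q) where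
  perm := by simpa using h.perm_append_cons
  chain := by simpa using h.isChainFor_append_cons
  left i hi := by
    have := h.lt_of_mem (List.mem_append_left _ (List.mem_of_getLast? hi))
    exact curveEq_append_axisPoint (s := 0) this (h.left i hi)
  right i hi := by
    obtain rfl : w.length = i := by simpa using hi
    simp
  on i hi := by
    have hlt := lt_length_of_onCurve hi
    rw [List.length_append, List.length_singleton, Nat.lt_succ_iff_lt_or_eq] at hlt
    rcases hlt with hlt | rfl
    · left
      refine (h.on i (onCurve_of_append hlt hi)).resolve_right fun hr => ?_
      have := (onCurve_append_iff hlt (h.right i hr) _).1 hi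
      simp at this
    · simp

end ExcState

lemma EuclidPath.excState {k₁ k₂ : ℕ} {w : NearPoint} {a b : ℕ} {P Q : List ℕ}
    (h : EuclidPath k₁ k₂ w a b P Q) : ExcState w P Q := by
  induction h with
  | nil => exact ExcState.nil
  | zero _ _ ih => exact ih.append_zero
  | infty _ _ ih => exact ih.append_infty

/-! ### The invariant of the resolution -/

/-- The weight of an exceptional curve after the blowup with centre `w`. -/
def weight (w : NearPoint) (i : ℕ) : ℤ := -selfInter w i

lemma weight_length (w : NearPoint) : weight w w.length = 1 := by
  rw [weight, selfInter_length, neg_neg]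

lemma weight_append_of_onCurve {w : NearPoint} {i : ℕ} {z : OnePoint ℂ}
    (h : OnCurve i (w ++ [z])) : weight (w ++ [z]) i = weight w i + 1 := by
  have := lt_length_of_onCurve h
  rw [weight, weight, selfInter_append (by simp at this; omega), if_pos h]
  ring

lemma weight_append_of_not_onCurve {w : NearPoint} {i : ℕ} {z : OnePoint ℂ} (hi : i ≤ w.length)
    (h : ¬ OnCurve i (w ++ [z])) : weight (w ++ [z]) i = weight w i := by
  rw [weight, weight, selfInter_append hi, if_neg h, sub_zero]

namespace ExcState

variable {w : NearPoint} {P Q : List ℕ}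

lemma map_weight_left {z : OnePoint ℂ} (h : ExcState (w ++ [z]) P Q) {R : List ℕ} {p : ℕ}
    (hP : P = R ++ [p]) : P.map (weight (w ++ [z])) = R.map (weight w) ++ [weight w p + 1] := by
  subst hP
  rw [List.map_append, List.map_singleton, weight_append_of_onCurve]
  · congr 1
    refine List.map_congr_left fun i hi => ?_
    have hmem : i ∈ R ++ [p] := List.mem_append_left _ hi
    have hlt := h.lt_of_mem (List.mem_append_left _ hmem)
    refine weight_append_of_not_onCurve (by simp at hlt; omega) ?_
    rw [h.onCurve_left_iff hmem]
    intro he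
    have hne := (List.nodup_append.1 (List.Nodup.of_append_left h.nodup)).2.2 i hi p (by simp)
    simp at he
    exact hne he.symm
  · rw [h.onCurve_left_iff (by simp)]
    simp

lemma map_weight_right {z : OnePoint ℂ} (h : ExcState (w ++ [z]) P Q) {R : List ℕ} {q : ℕ}
    (hQ : Q = q :: R) : Q.map (weight (w ++ [z])) = (weight w q + 1) :: R.map (weight w) := by
  subst hQ
  rw [List.map_cons, weight_append_of_onCurve]
  · congr 1
    refine List.map_congr_left fun i hi => ?_
    have hmem : i ∈ q :: R := List.mem_cons_of_mem _ hi
    have hlt := h.lt_of_mem (List.mem_append_right _ hmem)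
    refine weight_append_of_not_onCurve (by simp at hlt; omega) ?_
    rw [h.onCurve_right_iff hmem]
    intro he
    have hne := (List.nodup_cons.1 (List.Nodup.of_append_right h.nodup)).1
    simp at he
    exact hne (he ▸ hi)
  · rw [h.onCurve_right_iff (by simp)]
    simp

/-- The determinants of the left part after an additional blowup of a point on its last curve. -/
lemma det_left {z : OnePoint ℂ} (h : ExcState (w ++ [z]) P Q) :
    chainDet (P.map (weight (w ++ [z]))) =
        chainDet (P.map (weight w)) + initDet (P.map (weight w)) ∧
      initDet (P.map (weight (w ++ [z]))) = initDet (P.map (weight w)) := by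
  rcases List.eq_nil_or_concat' P with rfl | ⟨R, p, rfl⟩
  · simp
  · rw [h.map_weight_left rfl, List.map_append, List.map_singleton]
    simp only [chainDet_append_singleton, initDet_append_singleton, and_true]
    ring

lemma det_right {z : OnePoint ℂ} (h : ExcState (w ++ [z]) P Q) :
    chainDet (Q.map (weight (w ++ [z]))) =
        chainDet (Q.map (weight w)) + tailDet (Q.map (weight w)) ∧
      tailDet (Q.map (weight (w ++ [z]))) = tailDet (Q.map (weight w)) := by
  rcases Q with _ | ⟨q, R⟩
  · simp
  · rw [h.map_weight_right rfl, List.map_cons]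
    simp only [chainDet_cons, tailDet_cons, and_true]
    ring

end ExcState

namespace EuclidPath

variable {k₁ k₂ : ℕ} {w : NearPoint} {a b : ℕ} {P Q : List ℕ}

/-- The invariants of the algorithm: the determinants of the two parts of the exceptional chain
express `k₁` and `k₂` through the current pair `(a, b)`. -/
lemma dets (h : EuclidPath k₁ k₂ w a b P Q) {A A' B B' : ℤ}
    (hA : A = chainDet (P.map (weight w))) (hA' : A' = initDet (P.map (weight w)))
    (hB : B = chainDet (Q.map (weight w))) (hB' : B' = tailDet (Q.map (weight w))) :
    (k₁ = (A - A') * a + A' * b ∧ k₂ = (B - B') * b + B' * a) ∧ A * B - A * B' - B * A' = 1 ∧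
      0 ≤ A' ∧ A' < A ∧ 0 ≤ B' ∧ B' < B := by
  subst hA hA' hB hB'
  induction h with
  | nil => simp
  | @zero w a b P Q h hlt ih =>
    obtain ⟨⟨i1, i2⟩, i3, i4, i5, i6, i7⟩ := ih
    have hs := h.excState.append_zero
    obtain ⟨r1, r2⟩ := hs.det_right
    have hP := hs.map_weight_left rfl
    rw [weight_length] at hP
    rw [r1, r2, hP, initDet_append_singleton, chainDet_append_singleton, Nat.cast_sub hlt.le]
    refine ⟨⟨?_, ?_⟩, ?_, ?_, ?_, ?_, ?_⟩
    · linear_combination i1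
    · linear_combination i2
    · linear_combination i3
    all_goals linarith
  | @infty w a b P Q h hlt ih =>
    obtain ⟨⟨i1, i2⟩, i3, i4, i5, i6, i7⟩ := ih
    have hs := h.excState.append_infty
    obtain ⟨r1, r2⟩ := hs.det_left
    have hQ := hs.map_weight_right rfl
    rw [weight_length] at hQ
    rw [r1, r2, hQ, tailDet_cons, chainDet_cons, Nat.cast_sub hlt.le]
    refine ⟨⟨?_, ?_⟩, ?_, ?_, ?_, ?_, ?_⟩
    · linear_combination i1
    · linear_combination i2
    · linear_combination i3
    all_goals linarith

/-- Since `k₁ ≥ k₂`, the chain begins with the first exceptional curve. -/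
lemma head_eq (h : EuclidPath k₁ k₂ w a b P Q) (hle : k₂ ≤ k₁) :
    (w = [] ∧ b ≤ a) ∨ P.head? = some 0 := by
  induction h with
  | nil => exact Or.inl ⟨rfl, hle⟩
  | zero _ _ ih =>
    right
    rcases ih with ⟨rfl, -⟩ | ih
    · obtain ⟨rfl, rfl⟩ := List.append_eq_nil_iff.1
        ‹EuclidPath k₁ k₂ [] _ _ _ _›.excState.perm.eq_nil
      simp
    · simp [ih]
  | infty _ hlt ih =>
    right
    rcases ih with ⟨-, ih⟩ | ih
    · omega
    · exact ih

end EuclidPath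

/-! ### Numberings of the exceptional chain -/

/-- The numbering is forced: after its first places, the next curve is the only new one that meets
the last of them. -/
lemma IsChainNumbering.unique {cs : NearPoint} {β β' : Equiv.Perm (Fin (numBlowups cs))}
    (h : IsChainNumbering cs β) (h' : IsChainNumbering cs β') : β = β' := by
  suffices ∀ n (hn : n < numBlowups cs), β ⟨n, hn⟩ = β' ⟨n, hn⟩ by
    ext i
    exact congrArg _ (this i i.2)
  intro n
  induction n using Nat.strong_induction_on with
  | _ n ih =>
    intro hn
    cases n with
    | zero => exact h.1.trans h'.1.symm
    | succ k =>
      obtain ⟨m, hm⟩ := β'.surjective (β ⟨k + 1, hn⟩)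
      have hk : k < numBlowups cs := by omega
      rcases Nat.lt_or_ge m (k + 1) with hlt | hge
      · have h1 : β m = β ⟨k + 1, hn⟩ := (ih m hlt m.2).trans hm
        have := congrArg Fin.val (β.injective h1)
        simp at this
        omega
      · have h1 := h.2 ⟨k, hk⟩ ⟨k + 1, hn⟩ (Fin.mk_lt_mk.2 (Nat.lt_succ_self k))
        have h2 := h'.2 ⟨k, hk⟩ m (Fin.lt_def.2 (by simpa using hge))
        rw [← hm, ih k (Nat.lt_succ_self k) hk, h2] at h1
        have : (m : ℕ) = k + 1 := by simpa using h1
        rw [← hm]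
        congr 1
        exact Fin.ext this

/-- A numbering of the exceptional chain, given as the list of the curves in their order. -/
lemma ExcState.exists_numbering {cs : NearPoint} {P Q : List ℕ} (h : ExcState cs P Q)
    (h0 : (P ++ cs.length :: Q).head? = some 0) :
    ∃ β : Equiv.Perm (Fin (numBlowups cs)), IsChainNumbering cs β ∧
      List.ofFn (fun j => ((β j : Fin (numBlowups cs)) : ℕ)) = P ++ cs.length :: Q := by
  set l := P ++ cs.length :: Q with hl
  have hperm := h.perm_append_cons
  rw [← hl] at hperm
  have hlen : l.length = numBlowups cs := by simpa [numBlowups] using hperm.length_eq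
  have hlt (j : Fin (numBlowups cs)) : l[(j : ℕ)]'(by omega) < numBlowups cs :=
    List.mem_range.1 (hperm.mem_iff.1 (List.getElem_mem _))
  have hnd : l.Nodup := hperm.nodup_iff.2 List.nodup_range
  let f : Fin (numBlowups cs) → Fin (numBlowups cs) := fun j => ⟨l[(j : ℕ)]'(by omega), hlt j⟩
  have hf : Function.Injective f := fun i j hij =>
    Fin.ext (hnd.getElem_inj_iff.1 (congrArg Fin.val hij))
  refine ⟨Equiv.ofBijective f (Finite.injective_iff_bijective.1 hf), ⟨?_, fun i j hij => ?_⟩, ?_⟩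
  · refine Fin.ext ?_
    rw [List.head?_eq_getElem?] at h0
    obtain ⟨_, h0⟩ := List.getElem?_eq_some_iff.1 h0
    exact h0
  · exact h.isChainFor_append_cons i j _ _ hij
  · refine List.ext_getElem (by simpa using hlen.symm) fun i h1 h2 => ?_
    simp [f]

lemma sBar_eq {cs : NearPoint} {P Q : List ℕ} {β : Equiv.Perm (Fin (numBlowups cs))}
    (hβ : List.ofFn (fun j => ((β j : Fin (numBlowups cs)) : ℕ)) = P ++ cs.length :: Q) :
    sBar cs β = ⟨chainDet (P.map (weight cs)), chainDet (Q.map (weight cs)),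
      initDet (P.map (weight cs)), tailDet (Q.map (weight cs))⟩ := by
  have hw : weights cs β = P.map (weight cs) ++ weight cs cs.length :: Q.map (weight cs) := by
    have := congrArg (List.map (weight cs)) hβ
    rw [List.map_ofFn, List.map_append, List.map_cons] at this
    exact this
  have hl : leftLength cs β = P.length := by
    have hlen : P.length < numBlowups cs := by
      have := congrArg List.length hβ
      simp at this
      omega
    have h1 : β ⟨P.length, hlen⟩ = Fin.last cs.length := by
      refine Fin.ext ?_
      have h2 : (List.ofFn (fun j => ((β j : Fin (numBlowups cs)) : ℕ)))[P.length]? =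
          (P ++ cs.length :: Q)[P.length]? := by rw [hβ]
      simpa [hlen] using h2
    rw [leftLength, ← h1, Equiv.symm_apply_apply]
  have ht : (weights cs β).take (leftLength cs β) = P.map (weight cs) := by
    rw [hw, hl]
    simp
  have hd : (weights cs β).drop (leftLength cs β + 1) = Q.map (weight cs) := by
    rw [hw, hl]
    simp [List.drop_append]
  simp only [sBar, ht, hd]
  rfl

/-! ### The resolution is a chain, and its correspondence with the path -/

lemma onCurve_of_meets {v w : NearPoint} {i : ℕ} (hw : w ∈ pointsOver v) (hn : OnCurve v.length w)
    (hi : i < v.length) (h : OnCurve i w) : OnCurve i v := by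
  obtain ⟨x, z, rfl⟩ := exists_append_of_mem_pointsOver hw
  have hx := (append_mem_pointsOver.1 hw).1
  have hlt := lt_length_of_onCurve hn
  obtain rfl : x = v := hx.eq_of_length_le (by simp at hlt; omega)
  exact onCurve_of_append hi h

/-- The old curves that meet the exceptional line of the blowup of `v` are axes at `v`. If there are
two of them, they are both axes, and each of the points `0` and `∞` of the line lies on one of
them. -/
lemma isSigmaChain_of_forall_axisPoint {cs : NearPoint}
    (h : ∀ j (hj : j < cs.length), ∃ s, cs[j] = axisPoint s) : IsSigmaChain cs := by
  rintro m hm i₁ hi₁ i₂ hi₂ hne ⟨w₁, hw₁, hn₁, ho₁⟩ ⟨w₂, hw₂, hn₂, ho₂⟩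
  have hlen : (cs.take m).length = m := by simp; omega
  set v := cs.take m with hv
  have h₁ := onCurve_of_meets hw₁ (by rwa [hlen]) (by omega) ho₁
  have h₂ := onCurve_of_meets hw₂ (by rwa [hlen]) (by omega) ho₂
  obtain ⟨s₁, hs₁⟩ := exists_curveEq_eq_X h₁
  obtain ⟨s₂, hs₂⟩ := exists_curveEq_eq_X h₂
  have hs : s₁ ≠ s₂ := by
    rintro rfl
    exact hne (curveEq_injective hs₁ hs₂)
  obtain ⟨s, hcs⟩ := h m hm
  rw [← List.take_append_getElem hm, ← hv, onCurve_append_iff (by omega) hs₁,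
    onCurve_append_iff (by omega) hs₂, hcs, axisPoint_injective.eq_iff, axisPoint_injective.eq_iff]
  omega

lemma EuclidPath.isSigmaChain {k₁ k₂ : ℕ} {cs : NearPoint} {a b : ℕ} {P Q : List ℕ}
    (h : EuclidPath k₁ k₂ cs a b P Q) : IsSigmaChain cs := by
  refine isSigmaChain_of_forall_axisPoint fun j hj => ?_
  obtain ⟨_, _, _, _, -, ⟨-, h'⟩ | ⟨-, h'⟩⟩ := h.take hj
  · exact ⟨1, h'⟩
  · exact ⟨0, h'⟩

lemma exponents_eq_of_sub_eq {a b a' b' : ℕ} (ha : 0 < a) (hb : 0 < b) (ha' : 0 < a')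
    (hb' : 0 < b') (h : (X 0 ^ a - X 1 ^ b : Poly) = X 0 ^ a' - X 1 ^ b') : a = a' ∧ b = b' := by
  have h1 := congrArg (restrict 1) h
  have h0 := congrArg (restrict 0) h
  simp only [map_sub, map_pow, restrict_X_self, restrict_X_of_ne (show (0 : Fin 2) ≠ 1 by simp),
    restrict_X_of_ne (show (1 : Fin 2) ≠ 0 by simp), zero_pow ha.ne', zero_pow hb.ne',
    zero_pow ha'.ne', zero_pow hb'.ne', sub_zero, zero_sub, neg_inj] at h0 h1
  constructor
  · simpa using congrArg Polynomial.natDegree h1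
  · simpa using congrArg Polynomial.natDegree h0

lemma label_of_isEdge {e : Arrow} (he : IsEdge e) {a b : ℕ} (h : pr e.src = ((a : ℤ), (b : ℤ))) :
    (2 * b ≤ a → e.label = .eps₁) ∧ (a < 2 * b → e.label = .eps₂) := by
  obtain ⟨h1, h2⟩ := Prod.mk.inj h
  obtain ⟨-, he⟩ := he
  rcases hl : e.label with _ | _
  all_goals
    rw [hl] at he
    have := he.1
    constructor <;> intro h3
    all_goals first | rfl | (exfalso; omega)

/-- The shape of the proper transform at a centre determines the place of this centre, and of the
corresponding edge. -/
lemma EuclidPath.corresponds_iff {k₁ k₂ : ℕ} {cs : NearPoint} {P Q : List ℕ}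
    (h : EuclidPath k₁ k₂ cs 1 1 P Q) (h₁ : 0 < k₁) (h₂ : 0 < k₂) (hle : k₂ ≤ k₁)
    (hc : k₁.Coprime k₂) {L : List Arrow} (hlen : L.length = numBlowups cs)
    (hL : ∀ i e, L[i]? = some e → IsEdge e ∧
      pr e.src = (((euclidStep^[i] (k₁, k₂)).1 : ℤ), ((euclidStep^[i] (k₁, k₂)).2 : ℤ)))
    {i : ℕ} (hi : i < numBlowups cs) {e : Arrow} (he : e ∈ L) :
    Corresponds k₁ k₂ cs i e ↔ L[i]? = some e := by
  have hk : sortPair k₁ k₂ = (k₁, k₂) := by simp [sortPair, hle]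
  have take_eq {j : ℕ} (hj : j < numBlowups cs) : ∃ a b, 0 < a ∧ 0 < b ∧
      proper (curveB k₁ k₂) (cs.take j) = X 0 ^ a - X 1 ^ b ∧
      sortPair a b = euclidStep^[j] (k₁, k₂) ∧
      euclidSteps k₁ k₂ = j + euclidSteps (sortPair a b).1 (sortPair a b).2 := by
    have hj' : j ≤ cs.length := Nat.lt_succ_iff.1 hj
    obtain ⟨a, b, P', Q', h'⟩ := h.exists_take hj'
    have e1 := h'.sortPair_eq
    have e2 := h'.euclidSteps_eq h₁ h₂ hc
    rw [hk, List.length_take_of_le hj'] at e1 e2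
    have hp := h'.pos_and_coprime h₁ h₂ hc
    exact ⟨a, b, hp.1, hp.2.1, h'.proper_curveB h₁ h₂ hc, e1, e2⟩
  obtain ⟨a, b, ha, hb, hprop, hsort, hsteps⟩ := take_eq hi
  constructor
  · rintro ⟨a', b', hpr, hor, -⟩
    obtain ⟨j, hj, rfl⟩ := List.getElem_of_mem he
    have hje : L[j]? = some L[j] := List.getElem?_eq_getElem hj
    obtain ⟨hE, hpr'⟩ := hL j _ hje
    obtain ⟨c, d, hc', hd', -, hsort', hsteps'⟩ := take_eq (hlen ▸ hj)
    obtain ⟨p1, p2⟩ := Prod.mk.inj hpr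
    have hpos2 := hE.1.1.2.2.1
    have hle' := hE.1.2
    have hs : sortPair a b = (a', b') := by
      rw [hprop] at hor
      rcases hor with hor | hor
      · obtain ⟨rfl, rfl⟩ := exponents_eq_of_sub_eq ha hb (by omega) (by omega) hor
        ext <;> simp [sortPair] <;> omega
      · obtain ⟨rfl, rfl⟩ := exponents_eq_of_sub_eq ha hb (by omega) (by omega) hor
        ext <;> simp [sortPair] <;> omega
    have hs' : sortPair c d = (a', b') := by
      rw [hpr, ← hsort'] at hpr'
      obtain ⟨q1, q2⟩ := Prod.mk.inj hpr'
      ext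
      · exact_mod_cast q1.symm
      · exact_mod_cast q2.symm
    rw [hs] at hsteps
    rw [hs'] at hsteps'
    obtain rfl : i = j := by omega
    exact hje
  · intro hie
    obtain ⟨hE, hpr⟩ := hL i e hie
    rw [← hsort] at hpr
    refine ⟨_, _, hpr, ?_, label_of_isEdge hE hpr⟩
    rw [hprop]
    rcases le_total a b with hab | hab
    · right
      simp [sortPair, hab]
    · left
      simp [sortPair, hab]

end SigmaProcess

end

theorem mainTheorem5 (k₁ k₂ : ℕ) (hk : (k₁, k₂) ∈ setO) :
    (∃! cs : NearPoint, IsSigmaChain cs ∧ Resolves (germ k₁ k₂) cs) ∧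
    ∀ cs : NearPoint, IsSigmaChain cs → Resolves (germ k₁ k₂) cs →
      (∃ β, IsChainNumbering cs β) ∧
      ∀ β, IsChainNumbering cs β →
        {s ∈ setOD | pr s = ((k₁ : ℤ), (k₂ : ℤ))} = {sBar cs β} ∧
        {s ∈ setODbar | pr s = ((k₁ : ℤ), (k₂ : ℤ))} = {sBar cs β} ∧
        level (sBar cs β) = euclidSteps k₁ k₂ + 1 ∧
        euclidSteps k₁ k₂ + 1 = numBlowups cs ∧
        ∃ L : List Arrow,
          IsPath (sBar cs β) root L ∧
          (∀ L' : List Arrow, IsPath (sBar cs β) root L' → L' = L) ∧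
          L.length = numBlowups cs ∧
          ∀ i < numBlowups cs, ∀ e ∈ L, Corresponds k₁ k₂ cs i e ↔ L[i]? = some e := by
  obtain ⟨h₁, h₂, hc, hle⟩ := hk
  dsimp only at h₁ h₂ hc hle
  obtain ⟨cs₀, P, Q, h⟩ := (EuclidPath.nil (k₁ := k₁) (k₂ := k₂)).exists_extend h₁ h₂ hc
  have hres := resolves_iff h h₁ h₂ hle hc
  refine ⟨⟨cs₀, ⟨h.isSigmaChain, (hres _).2 rfl⟩, fun cs' h' => (hres _).1 h'.2⟩, ?_⟩
  rintro cs - hcs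
  obtain rfl := (hres _).1 hcs
  have hhead : (P ++ cs.length :: Q).head? = some 0 := by
    rcases h.head_eq hle with ⟨rfl, -⟩ | hP
    · obtain ⟨rfl, rfl⟩ := List.append_eq_nil_iff.1 h.excState.perm.eq_nil
      rfl
    · simp [hP]
  obtain ⟨β₀, hβ₀, hlist⟩ := h.excState.exists_numbering hhead
  refine ⟨⟨β₀, hβ₀⟩, fun β hβ => ?_⟩
  obtain rfl := hβ.unique hβ₀
  obtain ⟨⟨d1, d2⟩, d3, d4, d5, d6, d7⟩ := h.dets rfl rfl rfl rfl
  rw [Nat.cast_one, mul_one, mul_one, sub_add_cancel] at d1 d2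
  have hs : sBar cs β ∈ setOD ∧ pr (sBar cs β) = ((k₁ : ℤ), (k₂ : ℤ)) := by
    rw [sBar_eq hlist]
    refine ⟨⟨⟨d3, ?_, ?_, d4, d5, d6, d7⟩, ?_⟩, ?_⟩
    · dsimp only
      omega
    · dsimp only
      omega
    · dsimp only
      omega
    · rw [pr, d1, d2]
  obtain ⟨hmem, hpr⟩ := hs
  have hsteps : euclidSteps k₁ k₂ = cs.length := by
    have := h.euclidSteps_eq h₁ h₂ hc
    simpa [sortPair, hle, euclidSteps_self] using this
  have hOD : {s ∈ setOD | pr s = ((k₁ : ℤ), (k₂ : ℤ))} = {sBar cs β} := by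
    ext s
    constructor
    · rintro ⟨h1, h2⟩
      exact eq_of_mem_setOD h1 hmem (h2.trans hpr.symm)
    · rintro rfl
      exact ⟨hmem, hpr⟩
  obtain ⟨L, hL1, hL2, hL3⟩ := exists_path hmem (k := (k₁, k₂)) hpr
  have hlen : L.length = numBlowups cs := by rw [hL2, hsteps, numBlowups]
  refine ⟨hOD, ?_, ?_, by rw [hsteps, numBlowups], L, (hL1 L).2 rfl, fun L' => (hL1 L').1, hlen,
    fun i hi e he => h.corresponds_iff h₁ h₂ hle hc hlen hL3 hi he⟩
  · rw [← hOD]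
    ext s
    constructor
    · rintro ⟨h1 | rfl, h2⟩
      · exact ⟨h1, h2⟩
      · have := (Prod.mk.inj h2).2
        simp [root] at this
        omega
    · rintro ⟨h1, h2⟩
      exact ⟨Or.inl h1, h2⟩
  · obtain ⟨e1, e2⟩ := Prod.mk.inj hpr
    rw [level, e1, e2, Int.toNat_natCast, Int.toNat_natCast]
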